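/- Let $k>2$ and $n\ge 0$ be integers, let $\mathcal{M}_k$ denote the complex $k\times k$ matrices, and let $\gamma_1,\dots,\gamma_n\in\mathcal{M}_k\otimes\mathcal{M}_k$ be nonzero states, i.e. nonzero positive semidefinite Hermitian matrices (no normalization is required). **Notation.** For $\gamma=\sum_i A_i\otimes B_i\in\mathcal{M}_m\otimes\mathcal{M}_m$ put $\gamma^{\Gamma}=\sum_i A_i\otimes B_i^{t}$ (partial transpose) and $\mathcal{R}(\gamma)=\sum_i \operatorname{vec}(A_i)\operatorname{vec}(B_i)^t$ (realignment), where $\operatorname{vec}(e_ae_c^t)=e_a\otimes e_c$; and define $G_\gamma,F_\gamma:\mathcal{M}_m\to\mathcal{M}_m$ by $G_\gamma(X)=\sum_i \operatorname{tr}(A_iX)B_i$, $F_\gamma(X)=\sum_i\operatorname{tr}(B_iX)A_i$. Consider the three conditions 1. $\gamma\ge 0$ and $\gamma^{\Gamma}\ge 0$; 2. $\gamma\ge 0$ and $\mathcal{R}(\gamma^{\Gamma})\ge 0$; 3. $\gamma\ge 0$ and $\mathcal{R}(\gamma)=\gamma$. A linear map $T:\mathcal{M}_m\to\mathcal{M}_m$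 that is positive (it preserves positive semidefiniteness) and self-adjoint for the trace inner product $\operatorname{tr}(XY^*)$ is *completely reducible* if there are orthogonal projections $W_1,\dots,W_l\in\mathcal{M}_m$ with $W_iW_j=0$ for $i\ne j$ such that $\mathcal{M}_m=\bigoplus_{i=1}^l W_i\mathcal{M}_mW_i\oplus R$, where $R$ is the orthogonal complement of $\bigoplus_{i=1}^l W_i\mathcal{M}_mW_i$; for every $i$, $T(W_i\mathcal{M}_mW_i)\subset W_i\mathcal{M}_mW_i$ and $T|_{W_i\mathcal{M}_mW_i}$ is irreducible (if $W$ is an orthogonal projection with $W\mathcal{M}_mW\subset W_i\mathcal{M}_mW_i$ and $T(W\mathcal{M}_mW)\subset W\mathcal{M}_mW$, then $W=0$ or $W=W_i$); and $T|_R\equiv 0$. A state $\gamma$ is *completely reducible* if $F_\gamma\circ G_\gamma$ is completely reducible. For $\gamma_i=\sum_{j}A^i_j\otimes B^i_j$ $(1\le i\le n)$ the *shuffle* is $$S(\gamma_1,\dots,\gamma_n)=\sum_{j_1,\dots,j_n}\bigl(A^1_{j_1}\otimes\cdots\otimes A^n_{j_n}\bigr)\otimes\bigl(B^1_{j_1}\otimes\cdots\otimes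 B^n_{j_n}\bigr)\in\mathcal{M}_{k^n}\otimes\mathcal{M}_{k^n}.$$ **Statement.** Assume that each $\gamma_j$ satisfies at least one of the conditions 1, 2, 3, and that for each of these three conditions there is at least one $\gamma_j$ that does not satisfy it. Then $S(\gamma_1,\dots,\gamma_n)\in\mathcal{M}_{k^n}\otimes\mathcal{M}_{k^n}$ is a completely reducible state, and it satisfies none of the conditions 1, 2, 3. -/

import Mathlib

open scoped Kronecker ComplexOrder

namespace BipartiteState

/-! ### Bipartite matrices

`M_k ⊗ M_m` is identified, via the Kronecker product, with the matrices indexed by `α × β`, where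
`α` and `β` index the canonical bases of the two factors:
`(A ⊗ B) (a, b) (c, d) = A a c * B b d`. -/

section Maps

variable {α β : Type*} [Fintype α] [Fintype β]

/-- The map `G_γ : M_k → M_m`, `G_γ(X) = ∑ i, tr(A_i X) B_i` for `γ = ∑ i, A_i ⊗ B_i`
(see `mapG_sum_kronecker`). -/
def mapG (γ : Matrix (α × β) (α × β) ℂ) : Matrix α α ℂ →ₗ[ℂ] Matrix β β ℂ where
  toFun X := Matrix.of fun b d => ∑ a, ∑ c, γ (a, b) (c, d) * X c a
  map_add' X Y := by
    ext b d
    simp [mul_add, Finset.sum_add_distrib]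
  map_smul' r X := by
    ext b d
    simp only [Matrix.smul_apply, Matrix.of_apply, smul_eq_mul, RingHom.id_apply, Finset.mul_sum]
    refine Finset.sum_congr rfl fun a _ => Finset.sum_congr rfl fun c _ => ?_
    ring

/-- The map `F_γ : M_m → M_k`, `F_γ(Y) = ∑ i, tr(B_i Y) A_i` for `γ = ∑ i, A_i ⊗ B_i`
(see `mapF_sum_kronecker`). -/
def mapF (γ : Matrix (α × β) (α × β) ℂ) : Matrix β β ℂ →ₗ[ℂ] Matrix α α ℂ where
  toFun Y := Matrix.of fun a c => ∑ b, ∑ d, γ (a, b) (c, d) * Y d b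
  map_add' X Y := by
    ext a c
    simp [mul_add, Finset.sum_add_distrib]
  map_smul' r X := by
    ext a c
    simp only [Matrix.smul_apply, Matrix.of_apply, smul_eq_mul, RingHom.id_apply, Finset.mul_sum]
    refine Finset.sum_congr rfl fun b _ => Finset.sum_congr rfl fun d _ => ?_
    ring

end Maps

theorem mapG_sum_kronecker {α β : Type*} [Fintype α] {J : Type*} [Fintype J] (A : J → Matrix α α ℂ) (B : J → Matrix β β ℂ)
    (X : Matrix α α ℂ) :
    mapG (∑ j, A j ⊗ₖ B j) X = ∑ j, (A j * X).trace • B j := by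
  ext b d
  simp only [mapG, LinearMap.coe_mk, AddHom.coe_mk, Matrix.of_apply, Matrix.sum_apply,
    Matrix.kroneckerMap_apply, Matrix.smul_apply, Matrix.trace, Matrix.diag_apply,
    Matrix.mul_apply, smul_eq_mul, Finset.sum_mul]
  conv_rhs => rw [Finset.sum_comm]; enter [2, a]; rw [Finset.sum_comm]
  refine Finset.sum_congr rfl fun a _ => Finset.sum_congr rfl fun c _ =>
    Finset.sum_congr rfl fun j _ => ?_
  ring

theorem mapF_sum_kronecker {α β : Type*} [Fintype β] {J : Type*} [Fintype J] (A : J → Matrix α α ℂ) (B : J → Matrix β β ℂ)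
    (Y : Matrix β β ℂ) :
    mapF (∑ j, A j ⊗ₖ B j) Y = ∑ j, (B j * Y).trace • A j := by
  ext a c
  simp only [mapF, LinearMap.coe_mk, AddHom.coe_mk, Matrix.of_apply, Matrix.sum_apply,
    Matrix.kroneckerMap_apply, Matrix.smul_apply, Matrix.trace, Matrix.diag_apply,
    Matrix.mul_apply, smul_eq_mul, Finset.sum_mul]
  conv_rhs => rw [Finset.sum_comm]; enter [2, b]; rw [Finset.sum_comm]
  refine Finset.sum_congr rfl fun b _ => Finset.sum_congr rfl fun d _ =>
    Finset.sum_congr rfl fun j _ => ?_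
  ring

/-! ### Partial transpose and realignment -/

/-- The partial transpose on the second factor, `(A ⊗ B)^Γ = A ⊗ Bᵗ`. -/
def partialTranspose {α β : Type*} (γ : Matrix (α × β) (α × β) ℂ) : Matrix (α × β) (α × β) ℂ :=
  Matrix.of fun p q => γ (p.1, q.2) (q.1, p.2)

theorem partialTranspose_kronecker {α β : Type*} (A : Matrix α α ℂ) (B : Matrix β β ℂ) :
    partialTranspose (A ⊗ₖ B) = A ⊗ₖ B.transpose := by
  ext p q
  simp [partialTranspose]

/-- The realignment, `R(A ⊗ B) = vec(A) vec(B)ᵗ`, where `vec(e_a e_cᵗ) = e_a ⊗ e_c`. -/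
def realignment {α : Type*} (γ : Matrix (α × α) (α × α) ℂ) : Matrix (α × α) (α × α) ℂ :=
  Matrix.of fun p q => γ (p.1, q.1) (p.2, q.2)

theorem realignment_kronecker {α : Type*} (A B : Matrix α α ℂ) :
    realignment (A ⊗ₖ B) =
      Matrix.vecMulVec (fun p : α × α => A p.1 p.2) (fun q : α × α => B q.1 q.2) := by
  ext p q
  simp [realignment, Matrix.vecMulVec_apply]

/-! ### States and the three conditions -/

/-- A (non-normalized) state: a positive semidefinite Hermitian matrix. -/
def IsState {α β : Type*} (γ : Matrix (α × β) (α × β) ℂ) : Prop :=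
  γ.PosSemidef

/-- Positive under partial transpose. -/
def IsPPT {α β : Type*} (γ : Matrix (α × β) (α × β) ℂ) : Prop :=
  γ.PosSemidef ∧ (partialTranspose γ).PosSemidef

/-- Positive under partial transpose composed with realignment. -/
def IsPositiveUnderPTRealignment {α : Type*} (γ : Matrix (α × α) (α × α) ℂ) : Prop :=
  γ.PosSemidef ∧ (realignment (partialTranspose γ)).PosSemidef

/-- Invariant under realignment. -/
def IsRealignmentInvariant {α : Type*} (γ : Matrix (α × α) (α × α) ℂ) : Prop :=
  γ.PosSemidef ∧ realignment γ = γ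

/-! ### Completely reducible maps -/

section Reducible

variable {α : Type*} [Fintype α]

/-- The sub-algebra `V M_k V = {V X V : X ∈ M_k}`, as a linear subspace of `M_k`. -/
def corner (V : Matrix α α ℂ) : Submodule ℂ (Matrix α α ℂ) where
  carrier := {Y | ∃ X, Y = V * X * V}
  zero_mem' := ⟨0, by simp⟩
  add_mem' := by
    rintro _ _ ⟨X, rfl⟩ ⟨Y, rfl⟩
    exact ⟨X + Y, by rw [mul_add, add_mul]⟩
  smul_mem' := by
    rintro r _ ⟨X, rfl⟩
    exact ⟨r • X, by simp⟩

/-- The orthogonal complement in `M_k` with respect to the trace inner product `tr(X Y*)`. -/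
def traceOrthogonal (U : Submodule ℂ (Matrix α α ℂ)) : Submodule ℂ (Matrix α α ℂ) where
  carrier := {X | ∀ Y ∈ U, (X * Y.conjTranspose).trace = 0}
  zero_mem' := by
    intro Y _
    simp
  add_mem' := by
    intro X X' hX hX' Y hY
    rw [add_mul, Matrix.trace_add, hX Y hY, hX' Y hY, add_zero]
  smul_mem' := by
    intro r X hX Y hY
    rw [Matrix.smul_mul, Matrix.trace_smul, hX Y hY, smul_zero]

/-- `T` sends positive semidefinite matrices to positive semidefinite matrices. -/
def IsPositiveMap (T : Matrix α α ℂ →ₗ[ℂ] Matrix α α ℂ) : Prop :=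
  ∀ X : Matrix α α ℂ, X.PosSemidef → (T X).PosSemidef

/-- `T` is self-adjoint with respect to the trace inner product. -/
def IsTraceSelfAdjoint (T : Matrix α α ℂ →ₗ[ℂ] Matrix α α ℂ) : Prop :=
  ∀ X Y : Matrix α α ℂ, (T X * Y.conjTranspose).trace = (X * (T Y).conjTranspose).trace

/-- The linear subspace `U` is left invariant by `T`. -/
def LeavesInvariant (T : Matrix α α ℂ →ₗ[ℂ] Matrix α α ℂ) (U : Submodule ℂ (Matrix α α ℂ)) :
    Prop :=
  ∀ X ∈ U, T X ∈ U

/-- The restriction of `T` to `V M_k V` is irreducible: the only sub-algebras `W M_k W` of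
`V M_k V`, with `W` an orthogonal projection, left invariant by `T` are those with `W = 0` or
`W = V`. (Used only when `T` is positive and leaves `V M_k V` invariant.) -/
def IsIrreducibleOn (T : Matrix α α ℂ →ₗ[ℂ] Matrix α α ℂ) (V : Matrix α α ℂ) : Prop :=
  ∀ W : Matrix α α ℂ, IsStarProjection W → corner W ≤ corner V → LeavesInvariant T (corner W) →
    W = 0 ∨ W = V

/-- A self-adjoint positive map `T : M_k → M_k` is completely reducible if there are mutually
orthogonal projections `W_1, …, W_l` such that
`M_k = W_1 M_k W_1 ⊕ … ⊕ W_l M_k W_l ⊕ R`, where `R` is the orthogonal complement of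
`W_1 M_k W_1 ⊕ … ⊕ W_l M_k W_l`, each `W_i M_k W_i` is left invariant by `T`, the restriction of
`T` to each of them is irreducible, and `T` vanishes on `R`. -/
def IsCompletelyReducibleMap (T : Matrix α α ℂ →ₗ[ℂ] Matrix α α ℂ) : Prop :=
  IsTraceSelfAdjoint T ∧ IsPositiveMap T ∧
    ∃ (l : ℕ) (W : Fin l → Matrix α α ℂ),
      (∀ i, IsStarProjection (W i)) ∧
      (∀ i j, i ≠ j → W i * W j = 0) ∧
      iSupIndep (fun i => corner (W i)) ∧
      IsCompl (⨆ i, corner (W i)) (traceOrthogonal (⨆ i, corner (W i))) ∧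
      (∀ i, LeavesInvariant T (corner (W i))) ∧
      (∀ i, IsIrreducibleOn T (W i)) ∧
      ∀ X ∈ traceOrthogonal (⨆ i, corner (W i)), T X = 0

end Reducible

/-- A completely reducible state: a state `γ` for which `F_γ ∘ G_γ` is completely reducible. -/
def IsCompletelyReducible {α β : Type*} [Fintype α] [Fintype β]
    (γ : Matrix (α × β) (α × β) ℂ) : Prop :=
  IsState γ ∧ IsCompletelyReducibleMap (mapF γ ∘ₗ mapG γ)

/-! ### The shuffle -/

section Shuffle

variable {ι α β : Type*} [Fintype ι]

/-- The tensor product `A_1 ⊗ … ⊗ A_n` in `M_k ⊗ … ⊗ M_k = M_{k^n}`, the rows and columns being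
indexed by the canonical basis `e_{p 1} ⊗ … ⊗ e_{p n}` of `ℂ^k ⊗ … ⊗ ℂ^k`. -/
def tensor (A : ι → Matrix α α ℂ) : Matrix (ι → α) (ι → α) ℂ :=
  Matrix.of fun p q => ∏ i, A i (p i) (q i)

/-- The shuffle `S(γ_1, …, γ_n)`: for `γ_i = ∑ j, A^i_j ⊗ B^i_j` it is the sum of all
`(A^1_{j_1} ⊗ … ⊗ A^n_{j_n}) ⊗ (B^1_{j_1} ⊗ … ⊗ B^n_{j_n})` (see `shuffle_sum_kronecker`). -/
def shuffle (γ : ι → Matrix (α × β) (α × β) ℂ) :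
    Matrix ((ι → α) × (ι → β)) ((ι → α) × (ι → β)) ℂ :=
  Matrix.of fun p q => ∏ i, γ i (p.1 i, p.2 i) (q.1 i, q.2 i)

theorem shuffle_sum_kronecker [DecidableEq ι] {J : ι → Type*} [∀ i, Fintype (J i)]
    (A : ∀ i, J i → Matrix α α ℂ) (B : ∀ i, J i → Matrix β β ℂ) :
    shuffle (fun i => ∑ j, A i j ⊗ₖ B i j) =
      ∑ f : (∀ i, J i), tensor (fun i => A i (f i)) ⊗ₖ tensor (fun i => B i (f i)) := by
  ext p q
  simp only [shuffle, tensor, Matrix.of_apply, Matrix.sum_apply, Matrix.kroneckerMap_apply]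
  rw [Finset.prod_univ_sum, Fintype.piFinset_univ]
  exact Finset.sum_congr rfl fun f _ => Finset.prod_mul_distrib

end Shuffle

end BipartiteState

/-! For a Hermitian `γ` the map `F_γ` is the adjoint of `G_γ`, so `T = F_γ ∘ G_γ` is not only a
positive map but also a positive semidefinite operator for the trace inner product. It is therefore
diagonalizable with nonnegative eigenvalues, and suitably normalized powers `T ^ m` applied to any
vector outside the kernel converge to an eigenvector.

Let `V` be the projection onto the range of a positive semidefinite eigenvector `X` of `T` with
positive eigenvalue, and `W` the projection onto the range of `G_γ X`. Positivity of `γ` gives `γ (V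
⊗ (1 - W)) = 0` and `γ ((1 - V) ⊗ W) = 0`. Each of the three conditions turns this into the
vanishing of `T` on `V M (1 - V)` (the three `hasDecompositionProperty` theorems). Splitting off
supports of minimal rank one after another then decomposes `T` into blocks
(`IsPerronMap.exists_isBlockFamily`).

For the shuffle, `F ∘ G` is the tensor product of the individual maps. Irreducibility alone does not
survive tensor products: an eigenvalue of the same modulus as the leading one can destroy it. Since
`T` is positive semidefinite, minimal blocks have a stronger property, primitivity: normalized
powers tend to the rank one map `Z ↦ tr(ρ Z) ρ`. This passes to tensor products
(`IsPrimitiveOn.tensor`) and implies irreducibility (`IsPrimitiveOn.isIrreducibleOn`), so products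
of blocks are the blocks of the shuffle.

For the negative claims, partial transpose and realignment act factorwise on a shuffle. If a tensor
product is positive semidefinite and every factor has a positive value as a quadratic form, every
factor is positive semidefinite. If the shuffle is fixed by realignment, every `γ_j` is proportional
to its realignment, and the scalar must be 1. Hence any condition satisfied by the shuffle would
hold for every factor. -/

namespace BipartiteState

open Matrix Filter Topology

/-! ### Positive semidefinite matrices and support projections -/

section PosSemidef

variable {n : Type*} [Fintype n]

open scoped MatrixOrder in
theorem exists_eq_conjTranspose_mul_self {A : Matrix n n ℂ} (hA : A.PosSemidef) :
    ∃ B : Matrix n n ℂ, A = Bᴴ * B := by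
  classical
  obtain ⟨B, hB⟩ := CStarAlgebra.nonneg_iff_eq_star_mul_self.mp hA.nonneg
  exact ⟨B, hB⟩

theorem trace_mul_nonneg {A B : Matrix n n ℂ} (hA : A.PosSemidef) (hB : B.PosSemidef) :
    0 ≤ (A * B).trace := by
  obtain ⟨C, rfl⟩ := exists_eq_conjTranspose_mul_self hA
  rw [Matrix.mul_assoc, Matrix.trace_mul_comm]
  exact (hB.mul_mul_conjTranspose_same C).trace_nonneg

/-- With `A = Cᴴ C` and `B = Dᴴ D`, the trace is the squared Frobenius norm of `C Dᴴ`. -/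
theorem mul_eq_zero_of_trace_mul_eq_zero {A B : Matrix n n ℂ} (hA : A.PosSemidef)
    (hB : B.PosSemidef) (h : (A * B).trace = 0) : A * B = 0 := by
  obtain ⟨C, rfl⟩ := exists_eq_conjTranspose_mul_self hA
  obtain ⟨D, rfl⟩ := exists_eq_conjTranspose_mul_self hB
  have h' : ((C * Dᴴ) * (C * Dᴴ)ᴴ).trace = 0 := by
    rw [← h, Matrix.mul_assoc Cᴴ, Matrix.trace_mul_comm Cᴴ]
    simp [Matrix.mul_assoc]
  rw [trace_mul_conjTranspose_self_eq_zero_iff] at h'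
  rw [Matrix.mul_assoc, ← Matrix.mul_assoc C, h']
  simp

theorem eq_zero_of_posSemidef_of_neg {A : Matrix n n ℂ} (hA : A.PosSemidef)
    (hA' : (-A).PosSemidef) : A = 0 := by
  have h1 := hA.trace_nonneg
  have h2 := hA'.trace_nonneg
  rw [trace_neg] at h2
  exact hA.trace_eq_zero_iff.mp (le_antisymm (by simpa using h2) h1)

theorem posSemidef_iff_forall_nonneg {A : Matrix n n ℂ} :
    A.PosSemidef ↔ ∀ x : n → ℂ, 0 ≤ star x ⬝ᵥ (A *ᵥ x) := by
  classical
  refine ⟨fun h x => h.dotProduct_mulVec_nonneg x, fun h => ?_⟩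
  refine .of_dotProduct_mulVec_nonneg ?_ h
  rw [← isSymmetric_toEuclideanLin_iff, LinearMap.isSymmetric_iff_inner_map_self_real]
  intro v
  have h1 := h v.ofLp
  have h2 : inner ℂ (toEuclideanLin A v) v = star (star v.ofLp ⬝ᵥ (A *ᵥ v.ofLp)) := by
    simp [EuclideanSpace.inner_eq_star_dotProduct, toEuclideanLin, dotProduct, mul_comm]
  rw [h2]
  have := (IsSelfAdjoint.of_nonneg h1).star_eq
  simp only [starRingEnd_apply, this]

theorem posSemidef_of_tendsto {f : ℕ → Matrix n n ℂ} {A : Matrix n n ℂ}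
    (hf : ∀ m, (f m).PosSemidef) (h : Tendsto f atTop (𝓝 A)) : A.PosSemidef := by
  rw [posSemidef_iff_forall_nonneg]
  intro x
  have hc : Continuous fun M : Matrix n n ℂ => star x ⬝ᵥ (M *ᵥ x) := by fun_prop
  exact ge_of_tendsto' ((hc.tendsto A).comp h) fun m => (hf m).dotProduct_mulVec_nonneg x

open scoped MatrixOrder Matrix.Norms.L2Operator in
theorem exists_smul_one_sub_posSemidef [DecidableEq n] {A : Matrix n n ℂ} (hA : A.IsHermitian) :
    ∃ c : ℝ, 0 ≤ c ∧ (c • (1 : Matrix n n ℂ) - A).PosSemidef := by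
  have hA' : IsSelfAdjoint A := hA
  refine ⟨‖A‖, norm_nonneg _, ?_⟩
  have := hA'.le_algebraMap_norm_self
  rw [Matrix.le_iff, Algebra.algebraMap_eq_smul_one] at this
  exact this

theorem _root_.IsStarProjection.posSemidef {V : Matrix n n ℂ} (hV : IsStarProjection V) :
    V.PosSemidef := by
  have h : V = Vᴴ * V := by
    rw [← star_eq_conjTranspose, hV.isSelfAdjoint.star_eq, hV.isIdempotentElem.eq]
  rw [h]
  exact posSemidef_conjTranspose_mul_self V

theorem _root_.IsStarProjection.conjTranspose_eq {V : Matrix n n ℂ} (hV : IsStarProjection V) :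
    Vᴴ = V := hV.isSelfAdjoint.star_eq

theorem _root_.IsStarProjection.mul_self {V : Matrix n n ℂ} (hV : IsStarProjection V) :
    V * V = V := hV.isIdempotentElem.eq

theorem exists_smul_sub_posSemidef [DecidableEq n] {V A : Matrix n n ℂ} (hV : IsStarProjection V)
    (hA : A.IsHermitian) (hVA : V * A * V = A) :
    ∃ c : ℝ, 0 ≤ c ∧ (c • V - A).PosSemidef := by
  obtain ⟨c, hc, h⟩ := exists_smul_one_sub_posSemidef hA
  refine ⟨c, hc, ?_⟩
  have := h.mul_mul_conjTranspose_same V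
  rw [hV.conjTranspose_eq] at this
  simpa [mul_sub, sub_mul, hVA, hV.mul_self] using this

/-- The orthogonal projection onto the range of a positive semidefinite matrix. -/
theorem exists_support [DecidableEq n] {X : Matrix n n ℂ} (hX : X.PosSemidef) :
    ∃ V N : Matrix n n ℂ, IsStarProjection V ∧ V * X = X ∧ N * X = V ∧
      ∃ c : ℝ, 0 ≤ c ∧ (c • X - V).PosSemidef := by
  set U := (hX.1.eigenvectorUnitary : Matrix n n ℂ) with hU
  set d := hX.1.eigenvalues with hd
  have hd0 : ∀ i, 0 ≤ d i := hX.eigenvalues_nonneg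
  have hUU : Uᴴ * U = 1 := by
    rw [hU, ← star_eq_conjTranspose]; exact Unitary.coe_star_mul_self _
  have hspec : X = U * diagonal (fun i => (d i : ℂ)) * Uᴴ := by
    have := hX.1.spectral_theorem
    rw [Unitary.conjStarAlgAut_apply] at this
    exact this
  have key : ∀ f g : n → ℂ, (U * diagonal f * Uᴴ) * (U * diagonal g * Uᴴ) =
      U * diagonal (fun i => f i * g i) * Uᴴ := by
    intro f g
    calc _ = U * diagonal f * (Uᴴ * U) * diagonal g * Uᴴ := by simp only [Matrix.mul_assoc]
      _ = _ := by rw [hUU, Matrix.mul_one, Matrix.mul_assoc U, diagonal_mul_diagonal]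
  have keyH : ∀ f : n → ℂ, (U * diagonal f * Uᴴ)ᴴ = U * diagonal (star f) * Uᴴ := by
    intro f
    simp [Matrix.mul_assoc, conjTranspose_mul]
  -- The second witness is the pseudo-inverse, using `0⁻¹ = 0`. The sum of the inverse eigenvalues
  -- bounds each of them, so this multiple of `X` dominates the support projection.
  refine ⟨U * diagonal (fun i => if d i = 0 then 0 else 1) * Uᴴ,
    U * diagonal (fun i => ((d i)⁻¹ : ℂ)) * Uᴴ, ⟨?_, ?_⟩, ?_, ?_, ∑ i, (d i)⁻¹,
    Finset.sum_nonneg fun i _ => inv_nonneg.mpr (hd0 i), ?_⟩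
  · rw [IsIdempotentElem, key]
    congr 3; ext i; split_ifs <;> simp
  · rw [IsSelfAdjoint, star_eq_conjTranspose, keyH]
    congr 3; ext i; simp only [Pi.star_apply]; split_ifs <;> simp
  · conv_lhs => rw [hspec]
    rw [key]; conv_rhs => rw [hspec]
    congr 3; ext i; split_ifs with h <;> simp [h]
  · conv_lhs => rw [hspec]
    rw [key]
    congr 3; ext i; split_ifs with h <;> simp [h]
  · have : (∑ i, (d i)⁻¹) • X - U * diagonal (fun i => if d i = 0 then 0 else 1) * Uᴴ =
        U * diagonal (fun i => (((∑ i, (d i)⁻¹) * d i - if d i = 0 then 0 else 1 : ℝ) : ℂ)) * Uᴴ := by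
      conv_lhs => rw [hspec]
      rw [← Matrix.smul_mul, ← Matrix.mul_smul, ← diagonal_smul, ← Matrix.sub_mul,
        ← Matrix.mul_sub, diagonal_sub]
      congr 3; ext i; split_ifs with h <;> simp
    rw [this]
    refine PosSemidef.mul_mul_conjTranspose_same (posSemidef_diagonal_iff.mpr fun i => ?_) U
    rw [Complex.zero_le_real]
    split_ifs with h
    · simp [h]
    · have h1 : (d i)⁻¹ ≤ ∑ i, (d i)⁻¹ :=
        Finset.single_le_sum (f := fun i => (d i)⁻¹)
          (fun i _ => inv_nonneg.mpr (hd0 i)) (Finset.mem_univ i)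
      have h2 := mul_le_mul_of_nonneg_right h1 (hd0 i)
      rw [inv_mul_cancel₀ h] at h2
      linarith

theorem eq_of_mul_eq_of_rank_le {V W : Matrix n n ℂ} (hV : IsStarProjection V)
    (hW : IsStarProjection W) (hVW : V * W = W) (h : V.rank ≤ W.rank) : W = V := by
  have hle : LinearMap.range W.mulVecLin ≤ LinearMap.range V.mulVecLin := by
    rintro _ ⟨x, rfl⟩
    exact ⟨W *ᵥ x, by simp [hVW]⟩
  have heq := Submodule.eq_of_le_of_finrank_le hle h
  have hWV : W * V = V := by
    classical
    refine Matrix.ext_of_mulVec_single fun i => ?_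
    have : V *ᵥ Pi.single i 1 ∈ LinearMap.range W.mulVecLin := by
      rw [heq]; exact ⟨_, rfl⟩
    obtain ⟨y, hy⟩ := this
    rw [← mulVec_mulVec, ← hy]
    simp [hW.mul_self]
  have := congrArg conjTranspose hVW
  rw [conjTranspose_mul, hV.conjTranspose_eq, hW.conjTranspose_eq, hWV] at this
  exact this.symm

end PosSemidef

/-! ### Convergence of normalized powers -/

/-- Normalized powers of `T` applied to a vector outside of the kernel converge to an eigenvector. -/
def HasPowerLimits {E : Type*} [AddCommGroup E] [Module ℂ E] [TopologicalSpace E]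
    (T : E →ₗ[ℂ] E) : Prop :=
  ∀ x, T x ≠ 0 → ∃ l : ℝ, 0 < l ∧ ∃ y, y ≠ 0 ∧ T y = l • y ∧
    Tendsto (fun m : ℕ => (l⁻¹) ^ m • (T ^ m) x) atTop (𝓝 y)

theorem hasPowerLimits_of_eigenbasis {E ι : Type*} [AddCommGroup E] [Module ℂ E]
    [TopologicalSpace E] [ContinuousAdd E] [ContinuousSMul ℂ E] [Fintype ι]
    (T : E →ₗ[ℂ] E) (b : Module.Basis ι ℂ E) (μ : ι → ℝ) (hμ : ∀ i, 0 ≤ μ i)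
    (hT : ∀ i, T (b i) = μ i • b i) : HasPowerLimits T := by
  classical
  intro x hx
  have hsum : x = ∑ i, b.repr x i • b i := (b.sum_repr x).symm
  have hTsmul : ∀ (r : ℝ) (z : E), T (r • z) = r • T z := fun r z => by
    rw [← Complex.coe_smul, map_smul, Complex.coe_smul]
  have hpow : ∀ m i, (T ^ m) (b i) = μ i ^ m • b i := by
    intro m i
    induction m with
    | zero => simp
    | succ m ih => rw [pow_succ', Module.End.mul_apply, ih, hTsmul, hT, smul_smul, pow_succ]
  let s := Finset.univ.filter fun i => b.repr x i ≠ 0 ∧ μ i ≠ 0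
  have hs : s.Nonempty := by
    by_contra hs
    apply hx
    rw [hsum, map_sum]
    refine Finset.sum_eq_zero fun i _ => ?_
    rw [map_smul, hT]
    by_cases h1 : b.repr x i = 0
    · simp [h1]
    by_cases h2 : μ i = 0
    · simp [h2]
    · exact absurd ⟨i, by simp [s, h1, h2]⟩ hs
  -- The normalization is the largest nonzero eigenvalue occurring in `x`. Every other component is
  -- multiplied by powers of a ratio in `[0, 1)`; nonnegativity of the spectrum excludes
  -- oscillation.
  obtain ⟨i₀, hi₀, hmax⟩ := s.exists_max_image μ hs
  simp only [s, Finset.mem_filter, Finset.mem_univ, true_and] at hi₀ hmax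
  have hl : 0 < μ i₀ := lt_of_le_of_ne (hμ i₀) (Ne.symm hi₀.2)
  refine ⟨μ i₀, hl, ∑ i, (if μ i = μ i₀ then b.repr x i else 0) • b i, ?_, ?_, ?_⟩
  · intro h0
    have := congrArg (fun z => b.repr z i₀) h0
    simp only [map_zero, Finsupp.zero_apply, b.repr_sum_self] at this
    exact hi₀.1 (by simpa using this)
  · rw [map_sum, Finset.smul_sum]
    refine Finset.sum_congr rfl fun i _ => ?_
    rw [map_smul, hT]
    split_ifs with h
    · rw [h, smul_comm]
    · simp
  · have : ∀ m : ℕ, ((μ i₀)⁻¹) ^ m • (T ^ m) x =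
        ∑ i, ((((μ i₀)⁻¹ * μ i) ^ m : ℝ) * b.repr x i : ℂ) • b i := by
      intro m
      conv_lhs => rw [hsum]
      rw [map_sum, Finset.smul_sum]
      refine Finset.sum_congr rfl fun i _ => ?_
      rw [map_smul, hpow, mul_smul, Complex.coe_smul, mul_pow, mul_smul]
      congr 1
      rw [smul_comm]
    simp only [this]
    refine tendsto_finsetSum _ fun i _ => Tendsto.smul_const ?_ _
    split_ifs with h
    · simp [h, inv_mul_cancel₀ hl.ne']
    by_cases hx0 : b.repr x i = 0
    · simp [hx0]
    have hlt : (μ i₀)⁻¹ * μ i < 1 := by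
      rw [inv_mul_lt_iff₀ hl, mul_one]
      by_cases hi : μ i = 0
      · rw [hi]; exact hl
      · exact lt_of_le_of_ne (hmax i ⟨hx0, hi⟩) h
    have h1 := tendsto_pow_atTop_nhds_zero_of_lt_one
      (mul_nonneg (inv_nonneg.mpr hl.le) (hμ i)) hlt
    have h2 := (Complex.continuous_ofReal.tendsto 0).comp h1
    simpa using h2.mul_const (b.repr x i)

/-- Diagonalization of a linear map whose matrix in some coordinates is positive semidefinite. -/
theorem hasPowerLimits_of_posSemidef {E ι : Type*} [AddCommGroup E] [Module ℂ E]
    [TopologicalSpace E] [ContinuousAdd E] [ContinuousSMul ℂ E] [Fintype ι] [DecidableEq ι]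
    (T : E →ₗ[ℂ] E) (e : E ≃ₗ[ℂ] (ι → ℂ)) (M : Matrix ι ι ℂ) (hM : M.PosSemidef)
    (hT : ∀ x, e (T x) = M *ᵥ e x) : HasPowerLimits T := by
  let b := (hM.1.eigenvectorBasis.toBasis.map (WithLp.linearEquiv 2 ℂ (ι → ℂ))).map e.symm
  refine hasPowerLimits_of_eigenbasis T b hM.1.eigenvalues hM.eigenvalues_nonneg fun i => ?_
  apply e.injective
  rw [hT, ← Complex.coe_smul, map_smul, Complex.coe_smul]
  simpa [b] using hM.1.mulVec_eigenvectorBasis i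

/-! ### Perron–Frobenius theory for self-adjoint positive maps -/

section Perron

variable {n : Type*} [Fintype n]

theorem exists_hermitian_add_I_smul {m : Type*} (Z : Matrix m m ℂ) :
    ∃ A B : Matrix m m ℂ, A.IsHermitian ∧ B.IsHermitian ∧ Z = A + Complex.I • B :=
  ⟨realPart Z, imaginaryPart Z, (realPart Z).2, (imaginaryPart Z).2,
    (realPart_add_I_smul_imaginaryPart Z).symm⟩

/-- Positive maps, self-adjoint for the trace form, whose normalized powers converge. -/
structure IsPerronMap (T : Matrix n n ℂ →ₗ[ℂ] Matrix n n ℂ) : Prop where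
  pos : IsPositiveMap T
  star : ∀ X, T Xᴴ = (T X)ᴴ
  symm : ∀ X Y, (T X * Y).trace = (X * T Y).trace
  limits : HasPowerLimits T

/-- `X` is a positive semidefinite eigenvector of `T`, with positive eigenvalue `l`, whose range is
the range of the projection `V`. -/
structure IsEigenSupport (T : Matrix n n ℂ →ₗ[ℂ] Matrix n n ℂ) (V : Matrix n n ℂ) (l : ℝ)
    (X : Matrix n n ℂ) : Prop where
  proj : IsStarProjection V
  ne_zero : V ≠ 0
  pos : 0 < l
  posSemidef : X.PosSemidef
  map_eq : T X = l • X
  mul_eq : V * X = X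
  factor : ∃ N, N * X = V
  dominated : ∃ c : ℝ, 0 ≤ c ∧ (c • X - V).PosSemidef

/-- The normalized powers of `T` on `V M V` converge to a rank one map onto the span of a positive
semidefinite matrix with the same range as `V`. -/
def IsPrimitiveOn (T : Matrix n n ℂ →ₗ[ℂ] Matrix n n ℂ) (V : Matrix n n ℂ) : Prop :=
  ∃ (c : ℂ) (ρ N : Matrix n n ℂ), ρ.PosSemidef ∧ N * ρ = V ∧
    ∀ Z, Tendsto (fun m : ℕ => c ^ m • (T ^ m) (V * Z * V)) atTop (𝓝 ((ρ * Z).trace • ρ))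

variable {T : Matrix n n ℂ →ₗ[ℂ] Matrix n n ℂ}

theorem mul_eq_zero_of_dominated {A B P : Matrix n n ℂ} (hA : A.PosSemidef)
    (hAB : (B - A).PosSemidef) (hP : P.PosSemidef) (h : (B * P).trace = 0) : A * P = 0 := by
  refine mul_eq_zero_of_trace_mul_eq_zero hA hP (le_antisymm ?_ (trace_mul_nonneg hA hP))
  have := trace_mul_nonneg hAB hP
  rw [Matrix.sub_mul, trace_sub, h, zero_sub] at this
  simpa using this

theorem mul_conj_mul_of_mul {V X : Matrix n n ℂ} (hV : IsStarProjection V) (hX : X.IsHermitian)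
    (h : V * X = X) : V * X * V = X := by
  have := congrArg conjTranspose h
  rw [conjTranspose_mul, hV.conjTranspose_eq, hX.eq] at this
  rw [h, this]

theorem hermitian_conj {V Z : Matrix n n ℂ} (hV : IsStarProjection V) (hZ : Z.IsHermitian) :
    (V * Z * V).IsHermitian := by
  rw [IsHermitian, conjTranspose_mul, conjTranspose_mul, hV.conjTranspose_eq, hZ.eq,
    Matrix.mul_assoc]

theorem conj_conj {V : Matrix n n ℂ} (hV : IsStarProjection V) (Z : Matrix n n ℂ) :
    V * (V * Z * V) * V = V * Z * V := by
  rw [Matrix.mul_assoc V Z, ← Matrix.mul_assoc V V, hV.mul_self, Matrix.mul_assoc,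
    Matrix.mul_assoc, hV.mul_self]

namespace IsPerronMap

theorem map_real_smul {m : Type*} (T : Matrix m m ℂ →ₗ[ℂ] Matrix m m ℂ) (r : ℝ)
    (X : Matrix m m ℂ) :
    T (r • X) = r • T X := LinearMap.map_smul_of_tower T r X

theorem pow_pos (hT : IsPerronMap T) (m : ℕ) {X : Matrix n n ℂ} (hX : X.PosSemidef) :
    ((T ^ m) X).PosSemidef := by
  induction m with
  | zero => simpa using hX
  | succ m ih => rw [pow_succ', Module.End.mul_apply]; exact hT.pos _ ih

theorem pow_star (hT : IsPerronMap T) (m : ℕ) {X : Matrix n n ℂ} (hX : X.IsHermitian) :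
    ((T ^ m) X).IsHermitian := by
  induction m with
  | zero => simpa using hX
  | succ m ih =>
    rw [pow_succ', Module.End.mul_apply, IsHermitian, ← hT.star, ih.eq]

/-- A Hermitian element of the corner lies between two real multiples of `V`, so positivity squeezes
its image between zeros. The general case follows by splitting into real and imaginary parts. -/
theorem map_conj_eq_zero [DecidableEq n] (hT : IsPerronMap T) {V : Matrix n n ℂ}
    (hV : IsStarProjection V) (h : T V = 0) (Z : Matrix n n ℂ) : T (V * Z * V) = 0 := by
  have key : ∀ A : Matrix n n ℂ, A.IsHermitian → T (V * A * V) = 0 := by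
    intro A hA
    have hA' := hermitian_conj hV hA
    obtain ⟨c, -, h1⟩ := exists_smul_sub_posSemidef hV hA' (conj_conj hV A)
    obtain ⟨d, -, h2⟩ := exists_smul_sub_posSemidef hV hA'.neg
      (by rw [Matrix.mul_neg, Matrix.neg_mul, conj_conj hV])
    have h1 := hT.pos _ h1
    have h2 := hT.pos _ h2
    rw [map_sub, map_real_smul, h, smul_zero, zero_sub] at h1 h2
    rw [map_neg, neg_neg] at h2
    exact eq_zero_of_posSemidef_of_neg h2 h1
  obtain ⟨A, B, hA, hB, rfl⟩ := exists_hermitian_add_I_smul Z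
  rw [Matrix.mul_add, Matrix.add_mul, map_add, key A hA, Matrix.mul_smul, Matrix.smul_mul,
    map_smul, key B hB, smul_zero, add_zero]

/-- The same squeeze: for Hermitian `A` in the corner, `0 ≤ c T(V) - T(A) ≤ (c + d) T(V)`, so the
range of `T(A)` stays inside that of `V`. -/
theorem map_mem_corner [DecidableEq n] (hT : IsPerronMap T) {V : Matrix n n ℂ}
    (hV : IsStarProjection V) (h : T V * (1 - V) = 0) (Z : Matrix n n ℂ) :
    V * T (V * Z * V) * V = T (V * Z * V) := by
  have key : ∀ A : Matrix n n ℂ, A.IsHermitian → V * T (V * A * V) * V = T (V * A * V) := by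
    intro A hA
    have hA' := hermitian_conj hV hA
    obtain ⟨c, -, h1⟩ := exists_smul_sub_posSemidef hV hA' (conj_conj hV A)
    obtain ⟨d, -, h2⟩ := exists_smul_sub_posSemidef hV hA'.neg
      (by rw [Matrix.mul_neg, Matrix.neg_mul, conj_conj hV])
    have h1 := hT.pos _ h1
    have h2 := hT.pos _ h2
    rw [map_sub, map_real_smul] at h1 h2
    rw [map_neg] at h2
    have h3 : (c • T V - T (V * A * V)) * (1 - V) = 0 := by
      refine mul_eq_zero_of_dominated (B := (c + d) • T V) h1 ?_ hV.one_sub.posSemidef ?_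
      · convert h2 using 1
        rw [add_smul]; abel
      · rw [Matrix.smul_mul, h]; simp
    rw [Matrix.sub_mul, Matrix.smul_mul, h, smul_zero, zero_sub, neg_eq_zero, Matrix.mul_sub,
      Matrix.mul_one, sub_eq_zero] at h3
    have h4 : (T (V * A * V)).IsHermitian := by rw [IsHermitian, ← hT.star, hA'.eq]
    refine mul_conj_mul_of_mul hV h4 ?_
    have := congrArg conjTranspose h3
    rw [conjTranspose_mul, hV.conjTranspose_eq, h4.eq] at this
    exact this.symm
  obtain ⟨A, B, hA, hB, rfl⟩ := exists_hermitian_add_I_smul Z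
  simp only [Matrix.mul_add, Matrix.add_mul, map_add, key A hA, Matrix.mul_smul, Matrix.smul_mul,
    map_smul, key B hB]

theorem pow_mem_corner {V : Matrix n n ℂ}
    (h : ∀ Z, V * T (V * Z * V) * V = T (V * Z * V)) (m : ℕ) {X : Matrix n n ℂ}
    (hX : V * X * V = X) : V * (T ^ m) X * V = (T ^ m) X := by
  induction m with
  | zero => simpa using hX
  | succ m ih =>
    rw [pow_succ', Module.End.mul_apply, ← ih, h]

theorem mul_mul_eq_of_tendsto {V A : Matrix n n ℂ} {f : ℕ → Matrix n n ℂ}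
    (hf : ∀ m, V * f m * V = f m) (h : Tendsto f atTop (𝓝 A)) : V * A * V = A := by
  have hc : Continuous fun M : Matrix n n ℂ => V * M * V := by fun_prop
  have h1 := (hc.tendsto A).comp h
  refine tendsto_nhds_unique h1 ?_
  simpa [Function.comp_def, hf] using h

theorem isHermitian_of_tendsto {m : Type*} {A : Matrix m m ℂ} {f : ℕ → Matrix m m ℂ}
    (hf : ∀ m, (f m).IsHermitian) (h : Tendsto f atTop (𝓝 A)) : A.IsHermitian := by
  have hc : Continuous fun M : Matrix m m ℂ => Mᴴ := by fun_prop
  have h1 := (hc.tendsto A).comp h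
  refine tendsto_nhds_unique h1 ?_
  simpa [Function.comp_def, (hf _).eq] using h

theorem exists_eigenvector (hT : IsPerronMap T) {Q : Matrix n n ℂ} (hQ : IsStarProjection Q)
    (h : ∀ Z, Q * T (Q * Z * Q) * Q = T (Q * Z * Q)) (h0 : T Q ≠ 0) :
    ∃ (l : ℝ) (X : Matrix n n ℂ), 0 < l ∧ X.PosSemidef ∧ X ≠ 0 ∧ T X = l • X ∧ Q * X * Q = X := by
  obtain ⟨l, hl, X, hX0, hX, hlim⟩ := hT.limits Q h0
  refine ⟨l, X, hl, ?_, hX0, hX, ?_⟩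
  · exact posSemidef_of_tendsto
      (fun m => (hT.pow_pos m hQ.posSemidef).smul (by positivity)) hlim
  · refine mul_mul_eq_of_tendsto (fun m => ?_) hlim
    rw [Matrix.mul_smul, Matrix.smul_mul, pow_mem_corner h]
    rw [hQ.mul_self, hQ.mul_self]

end IsPerronMap

theorem exists_isEigenSupport [DecidableEq n] {l : ℝ} {X : Matrix n n ℂ} (hl : 0 < l)
    (hX : X.PosSemidef) (hX0 : X ≠ 0) (h : T X = l • X) : ∃ V, IsEigenSupport T V l X := by
  obtain ⟨V, N, hV, hVX, hN, hc⟩ := exists_support hX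
  refine ⟨V, hV, ?_, hl, hX, h, hVX, ⟨N, hN⟩, hc⟩
  rintro rfl
  exact hX0 (by simpa using hVX.symm)

namespace IsEigenSupport

variable {V X : Matrix n n ℂ} {l : ℝ}

theorem mul_projection (hV : IsEigenSupport T V l X) {Q : Matrix n n ℂ} (hQ : Q * X = X) :
    Q * V = V := by
  obtain ⟨N, hN⟩ := hV.factor
  have := congrArg conjTranspose hN
  rw [conjTranspose_mul, hV.proj.conjTranspose_eq, hV.posSemidef.1.eq] at this
  rw [← this, ← Matrix.mul_assoc, hQ]

theorem mul_mul_eq (hV : IsEigenSupport T V l X) : V * X * V = X :=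
  mul_conj_mul_of_mul hV.proj hV.posSemidef.1 hV.mul_eq

theorem mul_right_eq (hV : IsEigenSupport T V l X) : X * V = X := by
  conv_rhs => rw [← hV.mul_mul_eq]
  rw [hV.mul_eq]

theorem map_mul_one_sub [DecidableEq n] (hV : IsEigenSupport T V l X) (hT : IsPerronMap T) :
    T V * (1 - V) = 0 := by
  obtain ⟨c, -, h⟩ := hV.dominated
  have h := hT.pos _ h
  rw [map_sub, IsPerronMap.map_real_smul, hV.map_eq] at h
  refine mul_eq_zero_of_dominated (hT.pos _ hV.proj.posSemidef) h hV.proj.one_sub.posSemidef ?_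
  simp [Matrix.mul_sub, hV.mul_right_eq]

theorem map_mem_corner [DecidableEq n] (hV : IsEigenSupport T V l X) (hT : IsPerronMap T)
    (Z : Matrix n n ℂ) : V * T (V * Z * V) * V = T (V * Z * V) :=
  hT.map_mem_corner hV.proj (hV.map_mul_one_sub hT) Z

theorem ne_zero_right (hV : IsEigenSupport T V l X) : X ≠ 0 := by
  rintro rfl
  obtain ⟨N, hN⟩ := hV.factor
  exact hV.ne_zero (by simpa using hN.symm)

theorem exists_smul_sub [DecidableEq n] (hV : IsEigenSupport T V l X) {Y : Matrix n n ℂ}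
    (hY : Y.IsHermitian) (hVY : V * Y * V = Y) : ∃ c : ℝ, (c • X - Y).PosSemidef := by
  obtain ⟨c, hc, h⟩ := exists_smul_sub_posSemidef hV.proj hY hVY
  obtain ⟨d, hd, h'⟩ := hV.dominated
  refine ⟨c * d, ?_⟩
  have := (h'.smul hc).add h
  rwa [smul_sub, smul_smul, sub_add_sub_cancel] at this

/-- Take the least `c₀` with `c₀ X - Y ≥ 0`. If the difference is nonzero, it is an eigenvector with
support below `V`, hence equal to `V` by minimality of the rank. It then dominates a positive
multiple of `X`, so `c₀` could be decreased. -/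
theorem eq_smul_of_minimal [DecidableEq n] (hV : IsEigenSupport T V l X)
    (hmin : ∀ V' l' X', IsEigenSupport T V' l' X' → V * V' = V' → V.rank ≤ V'.rank)
    {Y : Matrix n n ℂ} (hY : Y.IsHermitian) (hVY : V * Y * V = Y) (hTY : T Y = l • Y) :
    ∃ c : ℝ, Y = c • X := by
  let S : Set ℝ := {c | (c • X - Y).PosSemidef}
  have hS : S.Nonempty := hV.exists_smul_sub hY hVY
  have hXtr : 0 < X.trace := lt_of_le_of_ne hV.posSemidef.trace_nonneg fun h =>
    hV.ne_zero_right (hV.posSemidef.trace_eq_zero_iff.mp h.symm)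
  have hbdd : BddBelow S := by
    refine ⟨Y.trace.re / X.trace.re, fun c hc => ?_⟩
    have h1 := (show (c • X - Y).PosSemidef from hc).trace_nonneg
    rw [trace_sub, trace_smul] at h1
    have h2 := (Complex.le_def.mp h1).1
    simp only [Complex.zero_re, Complex.sub_re, Complex.real_smul, Complex.re_ofReal_mul] at h2
    rw [div_le_iff₀ (Complex.lt_def.mp hXtr).1]
    linarith
  have hclosed : IsClosed S := by
    refine isClosed_of_closure_subset fun c hc => ?_
    obtain ⟨u, hu, hlim⟩ := mem_closure_iff_seq_limit.mp hc
    exact posSemidef_of_tendsto hu ((hlim.smul_const X).sub_const Y)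
  have hmem := hclosed.csInf_mem hS hbdd
  set c₀ := sInf S
  refine ⟨c₀, ?_⟩
  by_contra hne
  have hZ0 : c₀ • X - Y ≠ 0 := fun h => hne (sub_eq_zero.mp h).symm
  have hTZ : T (c₀ • X - Y) = l • (c₀ • X - Y) := by
    rw [map_sub, IsPerronMap.map_real_smul, hV.map_eq, hTY, smul_sub, smul_comm]
  obtain ⟨V', hV'⟩ := exists_isEigenSupport hV.pos hmem hZ0 hTZ
  have hVY' : V * Y = Y := by
    rw [← hVY, ← Matrix.mul_assoc, ← Matrix.mul_assoc, hV.proj.mul_self]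
  have hVV' : V * V' = V' := hV'.mul_projection (by
    rw [Matrix.mul_sub, Matrix.mul_smul, hV.mul_eq, hVY'])
  have heq : V' = V := eq_of_mul_eq_of_rank_le hV.proj hV'.proj hVV' (hmin _ _ _ hV' hVV')
  subst heq
  obtain ⟨k, hk⟩ := hV'.exists_smul_sub hV.posSemidef.1 hV.mul_mul_eq
  have hk0 : 0 < k := by
    by_contra hk0
    refine hV.ne_zero_right (eq_zero_of_posSemidef_of_neg hV.posSemidef ?_)
    have := hk.add (hmem.smul (neg_nonneg.mpr (not_lt.mp hk0)))
    convert this using 1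
    rw [neg_smul]; abel
  have hmem' : c₀ - k⁻¹ ∈ S := by
    have := hk.smul (inv_nonneg.mpr hk0.le)
    change PosSemidef _
    convert this using 1
    rw [smul_sub, smul_smul, inv_mul_cancel₀ hk0.ne', one_smul, sub_smul]
    abel
  have := csInf_le hbdd hmem'
  have h2 := inv_pos.mpr hk0
  linarith

theorem pow_map_eq (hV : IsEigenSupport T V l X) (m : ℕ) : (T ^ m) X = l ^ m • X := by
  induction m with
  | zero => simp
  | succ m ih =>
    rw [pow_succ', Module.End.mul_apply, ih, IsPerronMap.map_real_smul, hV.map_eq, smul_smul,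
      pow_succ]

/-- Let `l'` be the growth rate of `Y`. Both `Y` and `-Y` lie below multiples of `X`, which excludes
`l' > l`. If `l' = l`, the limit is an eigenvector for `l`, hence a multiple of `X`; if `l' < l`,
normalizing by `l` gives the limit 0. -/
theorem exists_tendsto [DecidableEq n] (hV : IsEigenSupport T V l X) (hT : IsPerronMap T)
    (hmin : ∀ V' l' X', IsEigenSupport T V' l' X' → V * V' = V' → V.rank ≤ V'.rank)
    {Y : Matrix n n ℂ} (hY : Y.IsHermitian) (hVY : V * Y * V = Y) :
    ∃ c : ℝ, Tendsto (fun m : ℕ => (l⁻¹) ^ m • (T ^ m) Y) atTop (𝓝 (c • X)) := by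
  by_cases h0 : T Y = 0
  · refine ⟨0, ?_⟩
    rw [zero_smul]
    refine tendsto_const_nhds.congr' ?_
    filter_upwards [eventually_ge_atTop 1] with m hm
    obtain ⟨k, rfl⟩ := Nat.exists_eq_add_of_le' hm
    rw [pow_succ T, Module.End.mul_apply, h0, map_zero, smul_zero]
  obtain ⟨l', hl', y, hy0, hy, hlim⟩ := hT.limits Y h0
  have hyH : y.IsHermitian := IsPerronMap.isHermitian_of_tendsto (fun m => by
    have := hT.pow_star m hY
    rw [IsHermitian, conjTranspose_smul, this.eq]; simp) hlim
  have hVy : V * y * V = y := IsPerronMap.mul_mul_eq_of_tendsto (fun m => by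
    rw [Matrix.mul_smul, Matrix.smul_mul,
      IsPerronMap.pow_mem_corner (hV.map_mem_corner hT) m hVY]) hlim
  rcases lt_trichotomy l l' with hlt | rfl | hlt
  · exfalso
    have key : ∀ Y' y' : Matrix n n ℂ, Y'.IsHermitian → V * Y' * V = Y' →
        Tendsto (fun m : ℕ => (l'⁻¹) ^ m • (T ^ m) Y') atTop (𝓝 y') → (-y').PosSemidef := by
      intro Y' y' hY' hVY' hlim'
      obtain ⟨c, hc⟩ := hV.exists_smul_sub hY' hVY'
      have h1 : ∀ m : ℕ, (((l'⁻¹ * l) ^ m * c) • X - (l'⁻¹) ^ m • (T ^ m) Y').PosSemidef := by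
        intro m
        have := (hT.pow_pos m hc).smul (a := (l'⁻¹) ^ m) (by positivity)
        rw [map_sub, IsPerronMap.map_real_smul, hV.pow_map_eq, smul_sub, smul_smul, smul_smul]
          at this
        convert this using 3
        rw [mul_pow]; ring
      have h2 : Tendsto (fun m : ℕ => ((l'⁻¹ * l) ^ m * c) • X - (l'⁻¹) ^ m • (T ^ m) Y') atTop
          (𝓝 (((0 : ℝ) * c) • X - y')) := by
        refine Tendsto.sub (Tendsto.smul_const (Tendsto.mul_const c ?_) X) hlim'
        refine tendsto_pow_atTop_nhds_zero_of_lt_one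
          (mul_nonneg (inv_nonneg.mpr hl'.le) hV.pos.le) ?_
        rwa [inv_mul_lt_iff₀ hl', mul_one]
      have := posSemidef_of_tendsto h1 h2
      simpa using this
    have h1 := key Y y hY hVY hlim
    have h2 := key (-Y) (-y) hY.neg (by rw [Matrix.mul_neg, Matrix.neg_mul, hVY]) (by
      simpa using hlim.neg)
    rw [neg_neg] at h2
    exact hy0 (eq_zero_of_posSemidef_of_neg h2 h1)
  · obtain ⟨c, rfl⟩ := hV.eq_smul_of_minimal hmin hyH hVy hy
    exact ⟨c, hlim⟩
  · refine ⟨0, ?_⟩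
    have h1 : Tendsto (fun m : ℕ => (l⁻¹ * l') ^ m • ((l'⁻¹) ^ m • (T ^ m) Y)) atTop
        (𝓝 ((0 : ℝ) • y)) := by
      refine Tendsto.smul ?_ hlim
      refine tendsto_pow_atTop_nhds_zero_of_lt_one
          (mul_nonneg (inv_nonneg.mpr hV.pos.le) hl'.le) ?_
      rwa [inv_mul_lt_iff₀ hV.pos, mul_one]
    rw [zero_smul] at h1 ⊢
    refine h1.congr fun m => ?_
    rw [smul_smul, ← mul_pow, mul_assoc, mul_inv_cancel₀ hl'.ne', mul_one]

theorem pow_trace (hV : IsEigenSupport T V l X) (hT : IsPerronMap T) (m : ℕ) (Y : Matrix n n ℂ) :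
    (X * (T ^ m) Y).trace = l ^ m • (X * Y).trace := by
  induction m with
  | zero => simp
  | succ m ih =>
    rw [pow_succ', Module.End.mul_apply, ← hT.symm, hV.map_eq, Matrix.smul_mul, trace_smul, ih,
      smul_smul, pow_succ']

/-- The limit is already known to be a multiple of `X`. Pairing with `X` identifies the coefficient
as `tr(X Y) / tr(X X)`, since this pairing is unchanged by the normalized powers. Then `ρ` is `X`
divided by its Frobenius norm. -/
theorem isPrimitiveOn [DecidableEq n] (hV : IsEigenSupport T V l X) (hT : IsPerronMap T)
    (hmin : ∀ V' l' X', IsEigenSupport T V' l' X' → V * V' = V' → V.rank ≤ V'.rank) :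
    IsPrimitiveOn T V := by
  have hXX : 0 < (X * X).trace := by
    refine lt_of_le_of_ne (trace_mul_nonneg hV.posSemidef hV.posSemidef) fun h => ?_
    refine hV.ne_zero_right (trace_conjTranspose_mul_self_eq_zero_iff.mp ?_)
    rw [hV.posSemidef.1.eq]
    exact h.symm
  obtain ⟨hs, hs'⟩ := Complex.lt_def.mp hXX
  set s : ℝ := (X * X).trace.re with hsdef
  have hXXs : (X * X).trace = (s : ℂ) := Complex.ext (by simp [hsdef]) (by simpa using hs'.symm)
  have hs : 0 < s := by simpa using hs
  have hsq : 0 < √s := Real.sqrt_pos.mpr hs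
  obtain ⟨N, hN⟩ := hV.factor
  have herm : ∀ Y : Matrix n n ℂ, Y.IsHermitian → V * Y * V = Y →
      Tendsto (fun m : ℕ => (l⁻¹) ^ m • (T ^ m) Y) atTop (𝓝 (((X * Y).trace / s) • X)) := by
    intro Y hY hVY
    obtain ⟨c, hc⟩ := hV.exists_tendsto hT hmin hY hVY
    have hcont : Continuous fun M : Matrix n n ℂ => (X * M).trace := by fun_prop
    have h1 := (hcont.tendsto _).comp hc
    have h2 : ∀ m : ℕ, (X * ((l⁻¹) ^ m • (T ^ m) Y)).trace = (X * Y).trace := by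
      intro m
      rw [Matrix.mul_smul, trace_smul, hV.pow_trace hT, smul_smul, ← mul_pow,
        inv_mul_cancel₀ hV.pos.ne', one_pow, one_smul]
    simp only [Function.comp_def, h2] at h1
    have h3 := tendsto_nhds_unique h1 tendsto_const_nhds
    rw [Matrix.mul_smul, trace_smul, hXXs, Complex.real_smul] at h3
    have h4 : (X * Y).trace / s = (c : ℂ) := by
      rw [← h3, mul_div_assoc, div_self (by exact_mod_cast hs.ne'), mul_one]
    rw [h4, Complex.coe_smul]
    exact hc
  refine ⟨((l⁻¹ : ℝ) : ℂ), (√s)⁻¹ • X, √s • N, hV.posSemidef.smul (by positivity), ?_, ?_⟩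
  · rw [Matrix.smul_mul, Matrix.mul_smul, smul_smul, mul_inv_cancel₀ hsq.ne', one_smul, hN]
  · intro Z
    obtain ⟨A, B, hA, hB, hZ⟩ := exists_hermitian_add_I_smul (V * Z * V)
    have hAB : V * Z * V = V * A * V + Complex.I • (V * B * V) := by
      rw [← conj_conj hV.proj, hZ, Matrix.mul_add, Matrix.add_mul, Matrix.mul_smul,
        Matrix.smul_mul]
    have h1 := (herm _ (hermitian_conj hV.proj hA) (conj_conj hV.proj A)).add
      ((herm _ (hermitian_conj hV.proj hB) (conj_conj hV.proj B)).const_smul Complex.I)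
    have h2 : (X * Z).trace = (X * (V * Z * V)).trace := by
      conv_lhs => rw [← hV.mul_mul_eq]
      rw [Matrix.mul_assoc (V * X), Matrix.mul_assoc V, trace_mul_comm V]
      simp only [Matrix.mul_assoc]
    have hlim : (((√s)⁻¹ • X * Z).trace • (√s)⁻¹ • X : Matrix n n ℂ) =
        ((X * (V * A * V)).trace / s) • X + Complex.I • ((X * (V * B * V)).trace / s) • X := by
      have h3 : (s : ℂ)⁻¹ = ((√s)⁻¹ : ℝ) * ((√s)⁻¹ : ℝ) := by
        rw [← Complex.ofReal_mul, ← mul_inv, Real.mul_self_sqrt hs.le, Complex.ofReal_inv]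
      rw [Matrix.smul_mul, trace_smul, h2, hAB, ← Complex.coe_smul, ← Complex.coe_smul, smul_smul,
        smul_smul, ← add_smul, Matrix.mul_add, trace_add, Matrix.mul_smul, trace_smul,
        div_eq_mul_inv, div_eq_mul_inv, h3]
      congr 1
      simp only [smul_eq_mul]
      ring
    rw [hlim]
    refine h1.congr fun m => ?_
    rw [hAB, map_add, map_smul, smul_add, ← Complex.ofReal_pow, Complex.coe_smul, Complex.coe_smul]
    congr 1
    rw [smul_comm]

end IsEigenSupport

/-- `T` vanishes on the off-diagonal blocks given by the range of any positive semidefinite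
eigenvector with positive eigenvalue. -/
def HasDecompositionProperty [DecidableEq n] (T : Matrix n n ℂ →ₗ[ℂ] Matrix n n ℂ) : Prop :=
  ∀ (V X : Matrix n n ℂ) (l : ℝ), IsEigenSupport T V l X → ∀ Z, T (V * Z * (1 - V)) = 0

/-- A decomposition of `T` into primitive blocks, supported on orthogonal projections below `Q`. -/
structure IsBlockFamily {ι : Type*} [Fintype ι] (T : Matrix n n ℂ →ₗ[ℂ] Matrix n n ℂ)
    (Q : Matrix n n ℂ) (V : ι → Matrix n n ℂ) : Prop where
  proj : ∀ i, IsStarProjection (V i)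
  mul_eq : ∀ i, Q * V i = V i
  orthogonal : ∀ i j, i ≠ j → V i * V j = 0
  invariant : ∀ i Z, V i * T (V i * Z * V i) * V i = T (V i * Z * V i)
  primitive : ∀ i, IsPrimitiveOn T (V i)
  map_eq_sum : ∀ Z, T (Q * Z * Q) = ∑ i, T (V i * Z * V i)

theorem IsPerronMap.exists_minimal [DecidableEq n] (hT : IsPerronMap T) {Q : Matrix n n ℂ}
    (hQ : IsStarProjection Q) (h : ∀ Z, Q * T (Q * Z * Q) * Q = T (Q * Z * Q)) (h0 : T Q ≠ 0) :
    ∃ V l X, IsEigenSupport T V l X ∧ Q * V = V ∧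
      ∀ V' l' X', IsEigenSupport T V' l' X' → V * V' = V' → V.rank ≤ V'.rank := by
  classical
  have hex : ∃ r V l X, IsEigenSupport T V l X ∧ Q * V = V ∧ V.rank = r := by
    obtain ⟨l, X, hl, hX, hX0, hTX, hQX⟩ := hT.exists_eigenvector hQ h h0
    obtain ⟨V, hV⟩ := exists_isEigenSupport hl hX hX0 hTX
    refine ⟨_, V, l, X, hV, hV.mul_projection ?_, rfl⟩
    rw [← hQX, ← Matrix.mul_assoc, ← Matrix.mul_assoc, hQ.mul_self]
  obtain ⟨V, l, X, hV, hQV, hr⟩ := Nat.find_spec hex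
  refine ⟨V, l, X, hV, hQV, fun V' l' X' hV' hVV' => ?_⟩
  rw [hr]
  refine Nat.find_min' hex ⟨V', l', X', hV', ?_, rfl⟩
  rw [← hVV', ← Matrix.mul_assoc, hQV]

/-- Induction on the rank of `Q`. If `T Q = 0`, the whole corner is killed and no block is needed.
Otherwise a support `V` of minimal rank is split off; the corner of `Q - V` is again invariant
because `T` is symmetric, and the off-diagonal terms vanish by the decomposition property. -/
theorem IsPerronMap.exists_isBlockFamily [DecidableEq n] (hT : IsPerronMap T)
    (hD : HasDecompositionProperty T) (Q : Matrix n n ℂ) (hQ : IsStarProjection Q)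
    (hTQ : T Q * (1 - Q) = 0) :
    ∃ (k : ℕ) (V : Fin k → Matrix n n ℂ), IsBlockFamily T Q V := by
  induction hr : Q.rank using Nat.strong_induction_on generalizing Q with
  | _ r ih =>
  have hinv := hT.map_mem_corner hQ hTQ
  by_cases h0 : T Q = 0
  · exact ⟨0, Fin.elim0, fun i => i.elim0, fun i => i.elim0, fun i => i.elim0, fun i => i.elim0,
      fun i => i.elim0, fun Z => by simp [hT.map_conj_eq_zero hQ h0]⟩
  obtain ⟨V, l, X, hV, hQV, hmin⟩ := hT.exists_minimal hQ hinv h0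
  have hVQ : V * Q = V := by
    have := congrArg conjTranspose hQV
    rwa [conjTranspose_mul, hV.proj.conjTranspose_eq, hQ.conjTranspose_eq] at this
  have hV1 := hV.map_mul_one_sub hT
  have hVinv := hV.map_mem_corner hT
  have hQ' : IsStarProjection (Q - V) := by
    refine ⟨?_, hQ.isSelfAdjoint.sub hV.proj.isSelfAdjoint⟩
    simp [IsIdempotentElem, Matrix.mul_sub, Matrix.sub_mul, hQV, hVQ, hQ.mul_self,
      hV.proj.mul_self]
  have hVQ' : V * (Q - V) = 0 := by rw [Matrix.mul_sub, hVQ, hV.proj.mul_self, sub_self]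
  have hQ'V : (Q - V) * V = 0 := by rw [Matrix.sub_mul, hQV, hV.proj.mul_self, sub_self]
  have hQQ' : Q * (Q - V) = Q - V := by rw [Matrix.mul_sub, hQV, hQ.mul_self]
  have hQ'Q : (Q - V) * Q = Q - V := by rw [Matrix.sub_mul, hVQ, hQ.mul_self]
  have hTVV : V * T V * V = T V := by
    have := hVinv 1
    rwa [Matrix.mul_one, hV.proj.mul_self] at this
  have hTQ'V : T (Q - V) * V = 0 := by
    refine mul_eq_zero_of_trace_mul_eq_zero (hT.pos _ hQ'.posSemidef) hV.proj.posSemidef ?_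
    rw [hT.symm, ← hTVV, ← Matrix.mul_assoc, ← Matrix.mul_assoc, hQ'V]
    simp
  have hTQ'Q : T (Q - V) * Q = T (Q - V) := by
    have := hinv (Q - V)
    rw [hQQ', hQ'Q] at this
    rw [← this, Matrix.mul_assoc, hQ.mul_self]
  have hTQ' : T (Q - V) * (1 - (Q - V)) = 0 := by
    rw [Matrix.mul_sub, Matrix.mul_sub, hTQ'V, hTQ'Q]
    simp
  have hlt : (Q - V).rank < r := by
    rw [← hr]
    by_contra hle
    have := eq_of_mul_eq_of_rank_le hQ hQ' hQQ' (not_lt.mp hle)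
    exact hV.ne_zero (by simpa using this)
  obtain ⟨k, W, hW⟩ := ih _ hlt (Q - V) hQ' hTQ' rfl
  have hVW : ∀ i, V * W i = 0 := fun i => by
    rw [← hW.mul_eq, ← Matrix.mul_assoc, hVQ', Matrix.zero_mul]
  have hWV : ∀ i, W i * V = 0 := fun i => by
    have := congrArg conjTranspose (hVW i)
    rwa [conjTranspose_mul, hV.proj.conjTranspose_eq, (hW.proj i).conjTranspose_eq,
      conjTranspose_zero] at this
  refine ⟨k + 1, Fin.cons V W, ?_, ?_, ?_, ?_, ?_, ?_⟩
  · exact Fin.cases hV.proj hW.proj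
  · refine Fin.cases hQV fun i => ?_
    rw [Fin.cons_succ, ← hW.mul_eq, ← Matrix.mul_assoc, hQQ']
  · refine Fin.cases (Fin.cases (by simp) ?_) fun i => Fin.cases ?_ ?_
    · intro j _; exact hVW j
    · intro _; exact hWV i
    · intro j hij
      exact hW.orthogonal i j fun h => hij (congrArg Fin.succ h)
  · exact Fin.cases hVinv hW.invariant
  · exact Fin.cases (hV.isPrimitiveOn hT hmin) hW.primitive
  · intro Z
    rw [Fin.sum_univ_succ]
    simp only [Fin.cons_zero, Fin.cons_succ]
    rw [← hW.map_eq_sum]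
    have hoff : ∀ Y, T (V * Y * (Q - V)) = 0 := by
      intro Y
      -- Inserting `Q` turns `1 - V` into `Q - V`, as `Q * (1 - V) = Q - V`.
      have := hD V X l hV (Y * Q)
      rwa [← Matrix.mul_assoc, Matrix.mul_assoc _ Q, Matrix.mul_sub, hQV, Matrix.mul_one] at this
    have hoff' : T ((Q - V) * Z * V) = 0 := by
      have h1 := hT.star (V * Zᴴ * (Q - V))
      rw [hoff, conjTranspose_zero, conjTranspose_mul, conjTranspose_mul, hQ'.conjTranspose_eq,
        hV.proj.conjTranspose_eq, conjTranspose_conjTranspose, ← Matrix.mul_assoc] at h1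
      exact h1
    have hsplit : Q * Z * Q = V * Z * V + V * Z * (Q - V) + (Q - V) * Z * V +
        (Q - V) * Z * (Q - V) := by
      noncomm_ring
    rw [hsplit, map_add, map_add, map_add, hoff, hoff', add_zero, add_zero]

end Perron

/-! ### The maps `G_γ` and `F_γ`, and the PPT case -/

section Maps

variable {α β : Type*} [Fintype α] [Fintype β] {γ : Matrix (α × β) (α × β) ℂ}

/-- The row-major vectorization of matrices. -/
def vecEquiv (α : Type*) : Matrix α α ℂ ≃ₗ[ℂ] (α × α → ℂ) where
  toFun X p := X p.1 p.2
  invFun x := Matrix.of fun i j => x (i, j)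
  map_add' _ _ := rfl
  map_smul' _ _ := rfl
  left_inv _ := rfl
  right_inv _ := rfl

theorem vecEquiv_apply {ι : Type*} (X : Matrix ι ι ℂ) (p : ι × ι) :
    vecEquiv ι X p = X p.1 p.2 := rfl

theorem vecEquiv_real_smul {ι : Type*} (r : ℝ) (X : Matrix ι ι ℂ) :
    vecEquiv ι (r • X) = r • vecEquiv ι X := rfl

theorem mapG_apply {β : Type*} (γ : Matrix (α × β) (α × β) ℂ) (X : Matrix α α ℂ) (b d : β) :
    mapG γ X b d = ∑ a, ∑ c, γ (a, b) (c, d) * X c a := rfl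

theorem mapF_apply {α : Type*} (γ : Matrix (α × β) (α × β) ℂ) (Y : Matrix β β ℂ) (a c : α) :
    mapF γ Y a c = ∑ b, ∑ d, γ (a, b) (c, d) * Y d b := rfl

theorem trace_mapG_mul (γ : Matrix (α × β) (α × β) ℂ) (X : Matrix α α ℂ) (Y : Matrix β β ℂ) :
    (mapG γ X * Y).trace = (γ * (X ⊗ₖ Y)).trace := by
  simp only [Matrix.trace, Matrix.diag_apply, Matrix.mul_apply, mapG_apply,
    Matrix.kroneckerMap_apply, Fintype.sum_prod_type, Finset.sum_mul]
  conv_lhs => enter [2, b]; rw [Finset.sum_comm]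
  rw [Finset.sum_comm]
  refine Finset.sum_congr rfl fun a _ => Finset.sum_congr rfl fun b _ => ?_
  rw [Finset.sum_comm]
  refine Finset.sum_congr rfl fun c _ => Finset.sum_congr rfl fun d _ => ?_
  ring

theorem trace_mul_mapF (γ : Matrix (α × β) (α × β) ℂ) (X : Matrix α α ℂ) (Y : Matrix β β ℂ) :
    (X * mapF γ Y).trace = (γ * (X ⊗ₖ Y)).trace := by
  rw [trace_mul_comm]
  simp only [Matrix.trace, Matrix.diag_apply, Matrix.mul_apply, mapF_apply,
    Matrix.kroneckerMap_apply, Fintype.sum_prod_type, Finset.sum_mul]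
  refine Finset.sum_congr rfl fun a _ => ?_
  rw [Finset.sum_comm]
  refine Finset.sum_congr rfl fun b _ => Finset.sum_congr rfl fun c _ =>
    Finset.sum_congr rfl fun d _ => ?_
  ring

theorem mapG_conjTranspose {β : Type*} {γ : Matrix (α × β) (α × β) ℂ} (hγ : γ.IsHermitian)
    (X : Matrix α α ℂ) : mapG γ Xᴴ = (mapG γ X)ᴴ := by
  ext b d
  rw [conjTranspose_apply, mapG_apply, mapG_apply, star_sum, Finset.sum_comm]
  refine Finset.sum_congr rfl fun a _ => ?_
  rw [star_sum]
  refine Finset.sum_congr rfl fun c _ => ?_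
  rw [star_mul', conjTranspose_apply, hγ.apply]

theorem mapF_conjTranspose {α : Type*} {γ : Matrix (α × β) (α × β) ℂ} (hγ : γ.IsHermitian)
    (Y : Matrix β β ℂ) : mapF γ Yᴴ = (mapF γ Y)ᴴ := by
  ext b d
  rw [conjTranspose_apply, mapF_apply, mapF_apply, star_sum, Finset.sum_comm]
  refine Finset.sum_congr rfl fun a _ => ?_
  rw [star_sum]
  refine Finset.sum_congr rfl fun c _ => ?_
  rw [star_mul', conjTranspose_apply, hγ.apply]

theorem posSemidef_of_forall_trace_mul_nonneg {M : Matrix α α ℂ}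
    (h : ∀ Y : Matrix α α ℂ, Y.PosSemidef → 0 ≤ (M * Y).trace) : M.PosSemidef := by
  rw [posSemidef_iff_forall_nonneg]
  intro x
  have := h _ (posSemidef_vecMulVec_self_star x)
  rwa [mul_vecMulVec, trace_vecMulVec, dotProduct_comm] at this

theorem mapG_posSemidef (hγ : γ.PosSemidef) {X : Matrix α α ℂ} (hX : X.PosSemidef) :
    (mapG γ X).PosSemidef := by
  classical
  refine posSemidef_of_forall_trace_mul_nonneg fun Y hY => ?_
  rw [trace_mapG_mul]
  exact trace_mul_nonneg hγ (hX.kronecker hY)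

theorem mapF_posSemidef (hγ : γ.PosSemidef) {Y : Matrix β β ℂ} (hY : Y.PosSemidef) :
    (mapF γ Y).PosSemidef := by
  classical
  refine posSemidef_of_forall_trace_mul_nonneg fun X hX => ?_
  rw [trace_mul_comm, trace_mul_mapF]
  exact trace_mul_nonneg hγ (hX.kronecker hY)

theorem hasPowerLimits_mapF_comp_mapG [DecidableEq α] (hγ : γ.IsHermitian) :
    HasPowerLimits (mapF γ ∘ₗ mapG γ) := by
  -- `K` is the matrix of `G_γ` in vectorized coordinates; as `γ` is Hermitian, that of `F_γ` is
  -- `Kᴴ`.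
  let K : Matrix (β × β) (α × α) ℂ := Matrix.of fun q p => γ (p.2, q.1) (p.1, q.2)
  refine hasPowerLimits_of_posSemidef _ (vecEquiv α) (Kᴴ * K)
    (posSemidef_conjTranspose_mul_self K) fun X => ?_
  rw [← mulVec_mulVec]
  have h1 : K *ᵥ vecEquiv α X = vecEquiv β (mapG γ X) := by
    ext q
    simp only [mulVec, dotProduct, vecEquiv_apply, mapG_apply, Fintype.sum_prod_type, K, of_apply]
    exact Finset.sum_comm
  rw [h1]
  ext p
  simp only [mulVec, dotProduct, vecEquiv_apply, LinearMap.comp_apply, mapF_apply,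
    Fintype.sum_prod_type, K, conjTranspose_apply, of_apply, hγ.apply]
  exact Finset.sum_comm

theorem isPerronMap_mapF_comp_mapG [DecidableEq α] (hγ : γ.PosSemidef) :
    IsPerronMap (mapF γ ∘ₗ mapG γ) where
  pos _ hX := mapF_posSemidef hγ (mapG_posSemidef hγ hX)
  star X := by
    rw [LinearMap.comp_apply, LinearMap.comp_apply, mapG_conjTranspose hγ.1,
      mapF_conjTranspose hγ.1]
  symm X Y := by
    rw [LinearMap.comp_apply, LinearMap.comp_apply, trace_mul_mapF, trace_mul_comm, trace_mul_mapF,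
      ← trace_mapG_mul, ← trace_mapG_mul, trace_mul_comm]
  limits := hasPowerLimits_mapF_comp_mapG hγ.1

section Support

variable {V X : Matrix α α ℂ} {l : ℝ} {W : Matrix β β ℂ}

theorem mul_kronecker_one_sub_eq_zero [DecidableEq β] (hγ : γ.PosSemidef)
    (hV : IsEigenSupport (mapF γ ∘ₗ mapG γ) V l X) (hW : IsStarProjection W)
    (hWG : W * mapG γ X = mapG γ X) : γ * (V ⊗ₖ (1 - W)) = 0 := by
  refine mul_eq_zero_of_trace_mul_eq_zero hγ
    (hV.proj.posSemidef.kronecker hW.one_sub.posSemidef) ?_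
  obtain ⟨c, -, hc⟩ := hV.dominated
  have h := mapG_posSemidef hγ hc
  rw [map_sub, LinearMap.map_smul_of_tower] at h
  rw [← trace_mapG_mul, mul_eq_zero_of_dominated (mapG_posSemidef hγ hV.proj.posSemidef) h
    hW.one_sub.posSemidef, trace_zero]
  have h2 := congrArg conjTranspose hWG
  rw [conjTranspose_mul, hW.conjTranspose_eq, (mapG_posSemidef hγ hV.posSemidef).1.eq] at h2
  rw [Matrix.smul_mul, Matrix.mul_sub, h2, Matrix.mul_one, sub_self, smul_zero, trace_zero]

theorem mul_one_sub_kronecker_eq_zero [DecidableEq α] (hγ : γ.PosSemidef)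
    (hV : IsEigenSupport (mapF γ ∘ₗ mapG γ) V l X) (hW : IsStarProjection W)
    (hWG : ∃ c : ℝ, 0 ≤ c ∧ (c • mapG γ X - W).PosSemidef) : γ * ((1 - V) ⊗ₖ W) = 0 := by
  refine mul_eq_zero_of_trace_mul_eq_zero hγ
    (hV.proj.one_sub.posSemidef.kronecker hW.posSemidef) ?_
  obtain ⟨c, -, hc⟩ := hWG
  have h := mapF_posSemidef hγ hc
  rw [map_sub, LinearMap.map_smul_of_tower] at h
  have h2 := hV.map_eq
  rw [LinearMap.comp_apply] at h2
  rw [← trace_mul_mapF, trace_mul_comm,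
    mul_eq_zero_of_dominated (mapF_posSemidef hγ hW.posSemidef) h
    hV.proj.one_sub.posSemidef, trace_zero]
  rw [h2, Matrix.smul_mul, Matrix.smul_mul, Matrix.mul_sub, hV.mul_right_eq, Matrix.mul_one,
    sub_self, smul_zero, smul_zero, trace_zero]

/-- The two kernel identities remove every block of `Y` except `W Y (1 - W)`. Each of the first two
conditions has only this block left to eliminate. -/
theorem trace_mapG_offDiagonal_mul [DecidableEq α] [DecidableEq β] (hγ : γ.PosSemidef)
    (hV : IsEigenSupport (mapF γ ∘ₗ mapG γ) V l X) (hW : IsStarProjection W)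
    (hWG : W * mapG γ X = mapG γ X)
    (hWG' : ∃ c : ℝ, 0 ≤ c ∧ (c • mapG γ X - W).PosSemidef) (Z : Matrix α α ℂ)
    (Y : Matrix β β ℂ) :
    (mapG γ (V * Z * (1 - V)) * Y).trace =
      (mapG γ (V * Z * (1 - V)) * (W * Y * (1 - W))).trace := by
  have h1 := mul_kronecker_one_sub_eq_zero hγ hV hW hWG
  have h2 := congrArg conjTranspose (mul_one_sub_kronecker_eq_zero hγ hV hW hWG')
  rw [conjTranspose_mul, hγ.1.eq, conjTranspose_zero, conjTranspose_kronecker,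
    hV.proj.one_sub.conjTranspose_eq, hW.conjTranspose_eq] at h2
  have k1 : ∀ Y', (mapG γ (V * Z * (1 - V)) * ((1 - W) * Y')).trace = 0 := fun Y' => by
    rw [trace_mapG_mul, Matrix.mul_assoc V, mul_kronecker_mul, ← Matrix.mul_assoc γ, h1,
      Matrix.zero_mul, trace_zero]
  have k2 : ∀ Y', (mapG γ (V * Z * (1 - V)) * (Y' * W)).trace = 0 := fun Y' => by
    rw [trace_mapG_mul, mul_kronecker_mul, ← Matrix.mul_assoc γ, trace_mul_comm,
      ← Matrix.mul_assoc, h2, Matrix.zero_mul, trace_zero]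
  have hY : Y = W * Y * (1 - W) + (1 - W) * Y + W * Y * W := by noncomm_ring
  conv_lhs => rw [hY]
  rw [Matrix.mul_add, Matrix.mul_add, trace_add, trace_add, k1, k2, add_zero, add_zero]

end Support

theorem trace_partialTranspose_mul_kronecker (γ : Matrix (α × β) (α × β) ℂ) (A : Matrix α α ℂ)
    (B : Matrix β β ℂ) :
    (partialTranspose γ * (A ⊗ₖ Bᵀ)).trace = (γ * (A ⊗ₖ B)).trace := by
  simp only [Matrix.trace, Matrix.diag_apply, Matrix.mul_apply, partialTranspose, of_apply,
    Matrix.kroneckerMap_apply, Fintype.sum_prod_type, transpose_apply]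
  refine Finset.sum_congr rfl fun a _ => ?_
  rw [Finset.sum_comm]
  conv_rhs => rw [Finset.sum_comm]
  refine Finset.sum_congr rfl fun c _ => ?_
  exact Finset.sum_comm

theorem _root_.IsStarProjection.transpose {V : Matrix α α ℂ} (hV : IsStarProjection V) :
    IsStarProjection Vᵀ := by
  refine ⟨?_, ?_⟩
  · rw [IsIdempotentElem, ← transpose_mul, hV.mul_self]
  · exact congrArg Matrix.transpose hV.conjTranspose_eq

/-- The trace of `γ (V ⊗ (1 - W))` is also that of `γ^Γ (V ⊗ (1 - W)ᵗ)`, so positivity of `γ^Γ`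
gives a kernel identity for `γ^Γ`. Transposition moves the right factor `1 - W` to the left, where
this identity kills the remaining block. -/
theorem IsPPT.hasDecompositionProperty [DecidableEq α] (hγ : IsPPT γ) :
    HasDecompositionProperty (mapF γ ∘ₗ mapG γ) := by
  classical
  intro V X l hV Z
  obtain ⟨W, -, hW, hWG, -, hWG'⟩ := exists_support (mapG_posSemidef hγ.1 hV.posSemidef)
  suffices h : mapG γ (V * Z * (1 - V)) = 0 by rw [LinearMap.comp_apply, h, map_zero]
  have h1 : partialTranspose γ * (V ⊗ₖ (1 - W)ᵀ) = 0 := by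
    refine mul_eq_zero_of_trace_mul_eq_zero hγ.2
      (hV.proj.posSemidef.kronecker hW.one_sub.posSemidef.transpose) ?_
    rw [trace_partialTranspose_mul_kronecker, mul_kronecker_one_sub_eq_zero hγ.1 hV hW hWG,
      trace_zero]
  refine ext_iff_trace_mul_right.mpr fun Y => ?_
  rw [Matrix.zero_mul, trace_zero, trace_mapG_offDiagonal_mul hγ.1 hV hW hWG hWG', trace_mapG_mul,
    ← trace_partialTranspose_mul_kronecker, transpose_mul, Matrix.mul_assoc V, mul_kronecker_mul,
    ← Matrix.mul_assoc, h1, Matrix.zero_mul, trace_zero]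

end Maps

/-- The defect `z = M x - √l x` satisfies `M z = -√l z`, which a positive semidefinite `M` allows
only for `z = 0`. -/
theorem mulVec_eq_sqrt_smul {ι : Type*} [Fintype ι] {M : Matrix ι ι ℂ} (hM : M.PosSemidef)
    {l : ℝ} (hl : 0 < l) {x : ι → ℂ} (h : M *ᵥ (M *ᵥ x) = l • x) : M *ᵥ x = √l • x := by
  have hs := Real.sqrt_pos.mpr hl
  set z := M *ᵥ x - √l • x with hz
  have hMz : M *ᵥ z = -(√l • z) := by
    rw [hz, mulVec_sub, h, mulVec_smul, smul_sub, smul_smul, Real.mul_self_sqrt hl.le]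
    abel
  have h1 := hM.dotProduct_mulVec_nonneg z
  rw [hMz, dotProduct_neg, dotProduct_smul, ← smul_neg] at h1
  have h2 := smul_nonneg (inv_pos.mpr hs).le h1
  rw [smul_smul, inv_mul_cancel₀ hs.ne', one_smul] at h2
  have h3 : star z ⬝ᵥ z = 0 := le_antisymm (by simpa using h2) (dotProduct_star_self_nonneg z)
  exact sub_eq_zero.mp (dotProduct_star_self_eq_zero.mp h3)

/-! ### The two realignment conditions -/

section Square

variable {α : Type*} [Fintype α] {γ : Matrix (α × α) (α × α) ℂ}

theorem vecEquiv_mapF (γ : Matrix (α × α) (α × α) ℂ) (X : Matrix α α ℂ) :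
    vecEquiv α (mapF γ X) = realignment (partialTranspose γ) *ᵥ vecEquiv α X := by
  ext p
  simp only [mulVec, dotProduct, vecEquiv_apply, mapF_apply, Fintype.sum_prod_type, realignment,
    partialTranspose, of_apply]
  exact Finset.sum_comm

theorem mapG_eq_mapF (hγ : γ.IsHermitian) (h : (realignment (partialTranspose γ)).IsHermitian) :
    mapG γ = mapF γ := by
  have hflip : ∀ a b c d, γ (a, b) (c, d) = γ (b, a) (d, c) := by
    intro a b c d
    have h1 := h.apply (a, c) (d, b)
    simp only [realignment, partialTranspose, of_apply] at h1
    rw [← h1, hγ.apply]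
  refine LinearMap.ext fun X => ?_
  ext b d
  rw [mapG_apply, mapF_apply]
  exact Finset.sum_congr rfl fun a _ => Finset.sum_congr rfl fun c _ => by rw [hflip]

theorem star_vecEquiv_dotProduct (X Y : Matrix α α ℂ) :
    star (vecEquiv α X) ⬝ᵥ vecEquiv α Y = (Y * Xᴴ).trace := by
  simp only [dotProduct, vecEquiv_apply, Fintype.sum_prod_type, Matrix.trace, diag_apply, mul_apply,
    conjTranspose_apply, Pi.star_apply]
  exact Finset.sum_congr rfl fun a _ => Finset.sum_congr rfl fun c _ => mul_comm _ _

/-- Here `G_γ = F_γ` is itself a positive semidefinite operator, with matrix `R(γ^Γ)`. Hence `X` is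
an eigenvector of `G_γ` and `W = V` is allowed. -/
theorem IsPositiveUnderPTRealignment.hasDecompositionProperty [DecidableEq α]
    (hγ : IsPositiveUnderPTRealignment γ) :
    HasDecompositionProperty (mapF γ ∘ₗ mapG γ) := by
  intro V X l hV Z
  have hGF := mapG_eq_mapF hγ.1.1 hγ.2.1
  have hGX : mapG γ X = √l • X := by
    apply (vecEquiv α).injective
    rw [hGF, vecEquiv_mapF, vecEquiv_real_smul]
    refine mulVec_eq_sqrt_smul hγ.2 hV.pos ?_
    rw [← vecEquiv_mapF, ← vecEquiv_mapF, ← vecEquiv_real_smul, ← hV.map_eq,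
      LinearMap.comp_apply, hGF]
  have hs := Real.sqrt_pos.mpr hV.pos
  obtain ⟨c, hc, hcV⟩ := hV.dominated
  have hWG : V * mapG γ X = mapG γ X := by rw [hGX, Matrix.mul_smul, hV.mul_eq]
  have hWG' : ∃ c : ℝ, 0 ≤ c ∧ (c • mapG γ X - V).PosSemidef := by
    refine ⟨c * (√l)⁻¹, by positivity, ?_⟩
    rwa [hGX, smul_smul, mul_assoc, inv_mul_cancel₀ hs.ne', mul_one]
  suffices h : mapG γ (V * Z * (1 - V)) = 0 by rw [LinearMap.comp_apply, h, map_zero]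
  -- Pairing the off-diagonal element with its own adjoint: the surviving block of the adjoint is
  -- zero, so the quadratic form of `R(γ^Γ)` vanishes there.
  have h0 := trace_mapG_offDiagonal_mul hγ.1 hV hV.proj hWG hWG' Z (V * Z * (1 - V))ᴴ
  have h1 : V * (V * Z * (1 - V))ᴴ * (1 - V) = 0 := by
    rw [conjTranspose_mul, conjTranspose_mul, hV.proj.one_sub.conjTranspose_eq,
      hV.proj.conjTranspose_eq, ← Matrix.mul_assoc V, Matrix.mul_sub V, hV.proj.mul_self]
    simp
  rw [h1, Matrix.mul_zero, trace_zero, ← star_vecEquiv_dotProduct, hGF, vecEquiv_mapF,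
    hγ.2.dotProduct_mulVec_zero_iff, ← vecEquiv_mapF] at h0
  rw [hGF]
  exact (vecEquiv α).map_eq_zero_iff.mp h0

theorem vecEquiv_mul_mul (A Z B : Matrix α α ℂ) :
    vecEquiv α (A * Z * B) = (A ⊗ₖ Bᵀ) *ᵥ vecEquiv α Z := by
  ext p
  simp only [mulVec, dotProduct, vecEquiv_apply, mul_apply, kroneckerMap_apply, transpose_apply,
    Fintype.sum_prod_type, Finset.sum_mul]
  rw [Finset.sum_comm]
  exact Finset.sum_congr rfl fun a _ => Finset.sum_congr rfl fun c _ => by ring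

theorem IsRealignmentInvariant.apply {α : Type*} {γ : Matrix (α × α) (α × α) ℂ}
    (hγ : IsRealignmentInvariant γ) (a b c d : α) :
    γ (a, b) (c, d) = γ (a, c) (b, d) :=
  (congrFun (congrFun hγ.2 (a, b)) (c, d)).symm

theorem IsRealignmentInvariant.vecEquiv_mapF (hγ : IsRealignmentInvariant γ) (X : Matrix α α ℂ) :
    vecEquiv α (mapF γ Xᵀ) = γ *ᵥ vecEquiv α X := by
  ext p
  simp only [mulVec, dotProduct, vecEquiv_apply, mapF_apply, Fintype.sum_prod_type, transpose_apply]
  exact Finset.sum_congr rfl fun b _ => Finset.sum_congr rfl fun d _ => by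
    rw [hγ.apply]

theorem IsRealignmentInvariant.vecEquiv_mapG (hγ : IsRealignmentInvariant γ) (X : Matrix α α ℂ) :
    vecEquiv α (mapG γ X)ᵀ = γ *ᵥ vecEquiv α X := by
  ext p
  simp only [mulVec, dotProduct, vecEquiv_apply, mapG_apply, Fintype.sum_prod_type, transpose_apply]
  rw [Finset.sum_comm]
  refine Finset.sum_congr rfl fun c _ => Finset.sum_congr rfl fun a _ => ?_
  rw [hγ.apply, ← hγ.1.1.apply, hγ.apply, hγ.1.1.apply, hγ.apply]

/-- Invariance makes `γ` itself the matrix of `X ↦ (G_γ X)ᵗ`. Hence `G_γ X = √l Xᵗ`, so `W = Vᵗ`,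
and `γ (V ⊗ (1 - Vᵗ)) = 0` says directly that `G_γ` kills `V M (1 - V)`. -/
theorem IsRealignmentInvariant.hasDecompositionProperty [DecidableEq α]
    (hγ : IsRealignmentInvariant γ) :
    HasDecompositionProperty (mapF γ ∘ₗ mapG γ) := by
  intro V X l hV Z
  have hGX : mapG γ X = √l • Xᵀ := by
    apply Matrix.transpose_injective
    apply (vecEquiv α).injective
    rw [hγ.vecEquiv_mapG, transpose_smul, transpose_transpose, vecEquiv_real_smul]
    refine mulVec_eq_sqrt_smul hγ.1 hV.pos ?_
    rw [← hγ.vecEquiv_mapG, ← hγ.vecEquiv_mapF, ← vecEquiv_real_smul, ← hV.map_eq,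
      LinearMap.comp_apply, transpose_transpose]
  have hWG : Vᵀ * mapG γ X = mapG γ X := by
    rw [hGX, Matrix.mul_smul, ← transpose_mul, hV.mul_right_eq]
  have h1 := mul_kronecker_one_sub_eq_zero hγ.1 hV hV.proj.transpose hWG
  suffices h : mapG γ (V * Z * (1 - V)) = 0 by rw [LinearMap.comp_apply, h, map_zero]
  apply Matrix.transpose_injective
  apply (vecEquiv α).injective
  rw [hγ.vecEquiv_mapG, vecEquiv_mul_mul, mulVec_mulVec, transpose_sub, transpose_one, h1]
  simp

end Square

/-! ### Tensor products, shuffles and products of blocks -/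

section Tensor

variable {ι α β : Type*} [Fintype ι]

theorem tensor_apply (A : ι → Matrix α α ℂ) (p q : ι → α) :
    tensor A p q = ∏ i, A i (p i) (q i) := rfl

theorem tensor_conjTranspose (A : ι → Matrix α α ℂ) :
    (tensor A)ᴴ = tensor fun i => (A i)ᴴ := by
  ext p q
  simp [tensor_apply, conjTranspose_apply]

theorem tensor_smul (c : ι → ℂ) (A : ι → Matrix α α ℂ) :
    tensor (fun i => c i • A i) = (∏ i, c i) • tensor A := by
  ext p q
  simp [tensor_apply, Finset.prod_mul_distrib]

theorem tensor_eq_zero {A : ι → Matrix α α ℂ} {i : ι} (h : A i = 0) : tensor A = 0 := by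
  ext p q
  rw [tensor_apply, Matrix.zero_apply]
  exact Finset.prod_eq_zero (Finset.mem_univ i) (by rw [h, Matrix.zero_apply])

theorem tendsto_tensor {f : ℕ → ι → Matrix α α ℂ} {A : ι → Matrix α α ℂ}
    (h : ∀ i, Tendsto (fun m => f m i) atTop (𝓝 (A i))) :
    Tendsto (fun m => tensor (f m)) atTop (𝓝 (tensor A)) := by
  refine tendsto_pi_nhds.mpr fun p => tendsto_pi_nhds.mpr fun q => ?_
  exact tendsto_finsetProd _ fun i _ =>
    tendsto_pi_nhds.mp (tendsto_pi_nhds.mp (h i) (p i)) (q i)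

variable [DecidableEq ι]

theorem tensor_sum {J : ι → Type*} [∀ i, Fintype (J i)] (A : ∀ i, J i → Matrix α α ℂ) :
    tensor (fun i => ∑ j, A i j) = ∑ f : ∀ i, J i, tensor fun i => A i (f i) := by
  ext p q
  simp only [tensor_apply, Matrix.sum_apply]
  rw [Finset.prod_univ_sum, Fintype.piFinset_univ]

variable [Fintype α] [Fintype β]

theorem tensor_mul (A B : ι → Matrix α α ℂ) :
    tensor A * tensor B = tensor fun i => A i * B i := by
  ext p q
  simp only [tensor_apply, mul_apply]
  rw [Finset.prod_univ_sum, Fintype.piFinset_univ]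
  exact Finset.sum_congr rfl fun _ _ => Finset.prod_mul_distrib.symm

theorem tensor_trace (A : ι → Matrix α α ℂ) : (tensor A).trace = ∏ i, (A i).trace := by
  simp only [Matrix.trace, diag_apply, tensor_apply]
  rw [Finset.prod_univ_sum, Fintype.piFinset_univ]

theorem tensor_posSemidef {A : ι → Matrix α α ℂ} (hA : ∀ i, (A i).PosSemidef) :
    (tensor A).PosSemidef := by
  choose B hB using fun i => exists_eq_conjTranspose_mul_self (hA i)
  rw [funext hB, ← tensor_mul, ← tensor_conjTranspose]
  exact posSemidef_conjTranspose_mul_self _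

theorem tensor_isStarProjection {A : ι → Matrix α α ℂ} (hA : ∀ i, IsStarProjection (A i)) :
    IsStarProjection (tensor A) := by
  refine ⟨?_, ?_⟩
  · rw [IsIdempotentElem, tensor_mul]
    simp only [(hA _).mul_self]
  · rw [IsSelfAdjoint, star_eq_conjTranspose, tensor_conjTranspose]
    simp only [(hA _).conjTranspose_eq]

theorem span_range_tensor [DecidableEq α] :
    Submodule.span ℂ (Set.range (tensor : (ι → Matrix α α ℂ) → _)) = ⊤ := by
  refine eq_top_iff.mpr fun X _ => ?_
  rw [matrix_eq_sum_single X]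
  refine Submodule.sum_mem _ fun p _ => Submodule.sum_mem _ fun q _ => ?_
  have : single p q (X p q) = X p q • tensor fun i => single (p i) (q i) (1 : ℂ) := by
    ext p' q'
    simp only [Matrix.smul_apply, tensor_apply, single_apply, smul_eq_mul]
    by_cases h : p = p' ∧ q = q'
    · obtain ⟨rfl, rfl⟩ := h
      simp
    · rw [if_neg h]
      have h' : ∃ i, ¬ (p i = p' i ∧ q i = q' i) := by
        by_contra hc
        push Not at hc
        exact h ⟨funext fun i => (hc i).1, funext fun i => (hc i).2⟩
      obtain ⟨i, hi⟩ := h'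
      rw [Finset.prod_eq_zero (Finset.mem_univ i) (if_neg hi), mul_zero]
  rw [this]
  exact Submodule.smul_mem _ _ (Submodule.subset_span ⟨_, rfl⟩)

theorem mapG_shuffle_tensor {β : Type*} (γ : ι → Matrix (α × β) (α × β) ℂ)
    (A : ι → Matrix α α ℂ) :
    mapG (shuffle γ) (tensor A) = tensor fun i => mapG (γ i) (A i) := by
  ext b d
  simp only [mapG_apply, tensor_apply, shuffle, of_apply]
  rw [Finset.prod_univ_sum, Fintype.piFinset_univ]
  refine Finset.sum_congr rfl fun a _ => ?_
  rw [Finset.prod_univ_sum, Fintype.piFinset_univ]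
  exact Finset.sum_congr rfl fun c _ => Finset.prod_mul_distrib.symm

theorem mapF_shuffle_tensor {α : Type*} (γ : ι → Matrix (α × β) (α × β) ℂ)
    (B : ι → Matrix β β ℂ) :
    mapF (shuffle γ) (tensor B) = tensor fun i => mapF (γ i) (B i) := by
  ext b d
  simp only [mapF_apply, tensor_apply, shuffle, of_apply]
  rw [Finset.prod_univ_sum, Fintype.piFinset_univ]
  refine Finset.sum_congr rfl fun a _ => ?_
  rw [Finset.prod_univ_sum, Fintype.piFinset_univ]
  exact Finset.sum_congr rfl fun c _ => Finset.prod_mul_distrib.symm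

section Blocks

variable {T : ι → Matrix α α ℂ →ₗ[ℂ] Matrix α α ℂ}
  {S : Matrix (ι → α) (ι → α) ℂ →ₗ[ℂ] Matrix (ι → α) (ι → α) ℂ}

theorem pow_map_tensor {ι α : Type*} [Fintype ι] {T : ι → Matrix α α ℂ →ₗ[ℂ] Matrix α α ℂ}
    {S : Matrix (ι → α) (ι → α) ℂ →ₗ[ℂ] Matrix (ι → α) (ι → α) ℂ}
    (hS : ∀ A, S (tensor A) = tensor fun i => T i (A i))
    (m : ℕ) (A : ι → Matrix α α ℂ) :
    (S ^ m) (tensor A) = tensor fun i => (T i ^ m) (A i) := by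
  induction m with
  | zero => simp
  | succ m ih => rw [pow_succ', Module.End.mul_apply, ih, hS]; simp [pow_succ']

/-- On elementary tensors the limits multiply, and a tensor product of maps `Z ↦ tr(ρ Z) ρ` has the
same form. Elementary tensors span, and the convergence is linear in `Z`. -/
theorem IsPrimitiveOn.tensor [DecidableEq α]
    (hS : ∀ A, S (tensor A) = tensor fun i => T i (A i)) {V : ι → Matrix α α ℂ}
    (hV : ∀ i, IsPrimitiveOn (T i) (V i)) : IsPrimitiveOn S (tensor V) := by
  choose c ρ N hρ hN hlim using hV
  refine ⟨∏ i, c i, BipartiteState.tensor ρ, BipartiteState.tensor N, tensor_posSemidef hρ, ?_, ?_⟩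
  · rw [tensor_mul, funext hN]
  · intro Z
    have hZ : Z ∈ Submodule.span ℂ
      (Set.range (BipartiteState.tensor : (ι → Matrix α α ℂ) → _)) := by
      rw [span_range_tensor]; trivial
    induction hZ using Submodule.span_induction with
    | mem Z hZ =>
      obtain ⟨A, rfl⟩ := hZ
      have h := tendsto_tensor fun i => hlim i (A i)
      rw [tensor_smul, ← tensor_trace, ← tensor_mul] at h
      refine h.congr fun m => ?_
      rw [tensor_smul, ← pow_map_tensor hS, ← tensor_mul, ← tensor_mul, Finset.prod_pow]
    | zero => simp
    | add X Y _ _ hX hY =>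
      simpa only [Matrix.mul_add, Matrix.add_mul, map_add, smul_add, trace_add, add_smul]
        using hX.add hY
    | smul a X _ hX =>
      have h := hX.const_smul a
      simp only [Matrix.mul_smul, Matrix.smul_mul, map_smul, trace_smul, smul_assoc]
      refine h.congr fun m => smul_comm _ _ _

theorem IsBlockFamily.tensor [DecidableEq α]
    (hS : ∀ A, S (tensor A) = tensor fun i => T i (A i)) {J : ι → Type*} [∀ i, Fintype (J i)]
    {V : ∀ i, J i → Matrix α α ℂ} (hV : ∀ i, IsBlockFamily (T i) 1 (V i)) :
    IsBlockFamily S 1 fun f : ∀ i, J i => tensor fun i => V i (f i) where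
  proj f := tensor_isStarProjection fun i => (hV i).proj (f i)
  mul_eq f := Matrix.one_mul _
  orthogonal f g hfg := by
    obtain ⟨i, hi⟩ := Function.ne_iff.mp hfg
    rw [tensor_mul]
    exact tensor_eq_zero (i := i) ((hV i).orthogonal _ _ hi)
  invariant f Z := by
    have hZ : Z ∈ Submodule.span ℂ
      (Set.range (BipartiteState.tensor : (ι → Matrix α α ℂ) → _)) := by
      rw [span_range_tensor]; trivial
    induction hZ using Submodule.span_induction with
    | mem Z hZ =>
      obtain ⟨A, rfl⟩ := hZ
      simp only [tensor_mul, hS, (hV _).invariant]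
    | zero => simp
    | add X Y _ _ hX hY => simp only [Matrix.mul_add, Matrix.add_mul, map_add, hX, hY]
    | smul a X _ hX => simp only [Matrix.mul_smul, Matrix.smul_mul, map_smul, hX]
  primitive f := IsPrimitiveOn.tensor hS fun i => (hV i).primitive (f i)
  map_eq_sum Z := by
    rw [Matrix.one_mul, Matrix.mul_one]
    have hZ : Z ∈ Submodule.span ℂ
      (Set.range (BipartiteState.tensor : (ι → Matrix α α ℂ) → _)) := by
      rw [span_range_tensor]; trivial
    induction hZ using Submodule.span_induction with
    | mem Z hZ =>
      obtain ⟨A, rfl⟩ := hZ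
      simp only [tensor_mul, hS]
      rw [← tensor_sum fun i j => T i (V i j * A i * V i j)]
      congr 1
      funext i
      rw [← (hV i).map_eq_sum, Matrix.one_mul, Matrix.mul_one]
    | zero => simp
    | add X Y _ _ hX hY =>
      simp only [Matrix.mul_add, Matrix.add_mul, map_add, hX, hY, Finset.sum_add_distrib]
    | smul a X _ hX =>
      simp only [Matrix.mul_smul, Matrix.smul_mul, map_smul, hX, Finset.smul_sum]

end Blocks

end Tensor

/-! ### From primitive blocks to complete reducibility -/

section CompletelyReducible

variable {n ι : Type*} [Fintype n] [Fintype ι] {T : Matrix n n ℂ →ₗ[ℂ] Matrix n n ℂ}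
  {V : ι → Matrix n n ℂ}

theorem mem_corner {W Y : Matrix n n ℂ} (hW : IsStarProjection W) :
    Y ∈ corner W ↔ W * Y * W = Y := by
  refine ⟨?_, fun h => ⟨Y, h.symm⟩⟩
  rintro ⟨X, rfl⟩
  exact conj_conj hW X

theorem mul_eq_of_corner_le {V W : Matrix n n ℂ} (hV : IsStarProjection V)
    (hW : IsStarProjection W) (h : corner W ≤ corner V) : V * W = W := by
  have h1 := (mem_corner hV).mp (h ((mem_corner hW).mpr (by rw [hW.mul_self, hW.mul_self])))
  rw [← h1, ← Matrix.mul_assoc, ← Matrix.mul_assoc, hV.mul_self]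

/-- Iterating from `W` stays in the invariant corner of `W` and tends to `tr(ρ W) ρ`. Either the
coefficient is zero and `ρ W = 0` forces `W = 0`, or `ρ` lies in that corner and `W` is everything.
-/
theorem IsPrimitiveOn.isIrreducibleOn {V₀ : Matrix n n ℂ} (h : IsPrimitiveOn T V₀) (hV : IsStarProjection V₀) :
    IsIrreducibleOn T V₀ := by
  intro W hW hWV hinv
  obtain ⟨c, ρ, N, hρ, hN, hlim⟩ := h
  have hVW := mul_eq_of_corner_le hV hW hWV
  have hlimW := hlim W
  rw [mul_conj_mul_of_mul hV hW.posSemidef.1 hVW] at hlimW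
  have hpow : ∀ m : ℕ, W * (T ^ m) W * W = (T ^ m) W := fun m =>
    IsPerronMap.pow_mem_corner
      (fun Z => (mem_corner hW).mp (hinv _ ⟨Z, rfl⟩)) m (by rw [hW.mul_self, hW.mul_self])
  have hρW := IsPerronMap.mul_mul_eq_of_tendsto (V := W) (fun m => by
    rw [Matrix.mul_smul, Matrix.smul_mul, hpow]) hlimW
  by_cases h0 : (ρ * W).trace = 0
  · left
    have := mul_eq_zero_of_trace_mul_eq_zero hρ hW.posSemidef h0
    rw [← hVW, ← hN, Matrix.mul_assoc, this, Matrix.mul_zero]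
  · right
    rw [Matrix.mul_smul, Matrix.smul_mul] at hρW
    have h1 : W * ρ * W = ρ := smul_right_injective _ h0 hρW
    have h2 : ρ * W = ρ := by rw [← h1, Matrix.mul_assoc, hW.mul_self]
    rw [← hVW, ← hN, Matrix.mul_assoc, h2]

theorem conj_eq_zero_of_mem_iSup {κ : Sort*} {U : κ → Matrix n n ℂ} {W Y : Matrix n n ℂ}
    (h : ∀ k, W * U k = 0) (hY : Y ∈ ⨆ k, corner (U k)) : W * Y = 0 := by
  have : ⨆ k, corner (U k) ≤ LinearMap.ker (LinearMap.mulLeft ℂ W) := by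
    refine iSup_le fun k => ?_
    rintro _ ⟨X, rfl⟩
    rw [LinearMap.mem_ker, LinearMap.mulLeft_apply, ← Matrix.mul_assoc, ← Matrix.mul_assoc, h]
    simp
  exact this hY

theorem mem_traceOrthogonal_iSup_corner {κ : Sort*} {U : κ → Matrix n n ℂ}
    (hU : ∀ k, IsStarProjection (U k)) {X : Matrix n n ℂ} :
    X ∈ traceOrthogonal (⨆ k, corner (U k)) ↔ ∀ k, U k * X * U k = 0 := by
  have key : ∀ k (Y : Matrix n n ℂ),
      (X * (U k * Y * U k)ᴴ).trace = (U k * X * U k * Yᴴ).trace := by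
    intro k Y
    rw [conjTranspose_mul, conjTranspose_mul, (hU k).conjTranspose_eq, ← Matrix.mul_assoc,
      ← Matrix.mul_assoc, trace_mul_comm]
    simp only [Matrix.mul_assoc]
  constructor
  · intro h k
    have h1 := h _ (Submodule.mem_iSup_of_mem k ⟨X, rfl⟩)
    rw [← conj_conj (hU k), key] at h1
    exact trace_mul_conjTranspose_self_eq_zero_iff.mp h1
  · intro h Y hY
    induction hY using Submodule.iSup_induction' with
    | mem k Y hY =>
      obtain ⟨Z, rfl⟩ := hY
      rw [key, h, Matrix.zero_mul, trace_zero]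
    | zero => simp
    | add Y Z _ _ hY hZ => rw [conjTranspose_add, Matrix.mul_add, trace_add, hY, hZ, add_zero]

theorem IsBlockFamily.isCompletelyReducibleMap [DecidableEq n] (hV : IsBlockFamily T 1 V)
    (hT : IsPerronMap T) : IsCompletelyReducibleMap T := by
  classical
  let e := (Fintype.equivFin ι).symm
  have horth : ∀ i j, i ≠ j → V (e i) * V (e j) = 0 := fun i j hij =>
    hV.orthogonal _ _ fun h => hij (e.injective h)
  refine ⟨fun X Y => ?_, hT.pos, Fintype.card ι, fun i => V (e i), fun i => hV.proj _, horth,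
    ?_, ⟨?_, ?_⟩, ?_, fun i => (hV.primitive _).isIrreducibleOn (hV.proj _), ?_⟩
  · rw [hT.symm, hT.star]
  · intro i
    rw [Submodule.disjoint_def]
    intro X hX hX'
    simp only [iSup_subtype'] at hX'
    rw [← (mem_corner (hV.proj (e i))).mp hX, conj_eq_zero_of_mem_iSup
      (U := fun j : {j // j ≠ i} => V (e j)) (fun j => horth _ _ j.2.symm) hX', Matrix.zero_mul]
  · rw [Submodule.disjoint_def]
    intro X hX hX'
    exact trace_mul_conjTranspose_self_eq_zero_iff.mp (hX' X hX)
  · rw [Submodule.codisjoint_iff_exists_add_eq]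
    intro X
    refine ⟨∑ i, V (e i) * X * V (e i), X - ∑ i, V (e i) * X * V (e i), ?_, ?_, by abel⟩
    · exact Submodule.sum_mem _ fun i _ => Submodule.mem_iSup_of_mem i ⟨X, rfl⟩
    · rw [mem_traceOrthogonal_iSup_corner fun i => hV.proj _]
      intro k
      rw [Matrix.mul_sub, Matrix.sub_mul, Finset.mul_sum, Finset.sum_mul,
        Finset.sum_eq_single k, conj_conj (hV.proj _), sub_self]
      · intro i _ hik
        rw [← Matrix.mul_assoc, ← Matrix.mul_assoc, horth _ _ hik.symm]
        simp
      · simp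
  · intro i X hX
    rw [← (mem_corner (hV.proj (e i))).mp hX, mem_corner (hV.proj (e i))]
    exact hV.invariant _ _
  · intro X hX
    rw [mem_traceOrthogonal_iSup_corner fun i => hV.proj _] at hX
    have := hV.map_eq_sum X
    rw [Matrix.one_mul, Matrix.mul_one] at this
    rw [this]
    refine Finset.sum_eq_zero fun i _ => ?_
    have h1 := hX (e.symm i)
    rw [e.apply_symm_apply] at h1
    rw [h1, map_zero]

end CompletelyReducible

theorem exists_isBlockFamily {α : Type*} [Fintype α] [DecidableEq α]
    {γ : Matrix (α × α) (α × α) ℂ}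
    (h : IsPPT γ ∨ IsPositiveUnderPTRealignment γ ∨ IsRealignmentInvariant γ) :
    ∃ (k : ℕ) (V : Fin k → Matrix α α ℂ), IsBlockFamily (mapF γ ∘ₗ mapG γ) 1 V := by
  have hγ : γ.PosSemidef := by
    rcases h with h | h | h <;> exact h.1
  have hD : HasDecompositionProperty (mapF γ ∘ₗ mapG γ) := by
    rcases h with h | h | h <;> exact h.hasDecompositionProperty
  exact (isPerronMap_mapF_comp_mapG hγ).exists_isBlockFamily hD 1 (.one _) (by simp)

theorem shuffle_posSemidef {ι α β : Type*} [Fintype ι] [DecidableEq ι] [Fintype α] [Fintype β]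
    {γ : ι → Matrix (α × β) (α × β) ℂ} (hγ : ∀ i, (γ i).PosSemidef) :
    (shuffle γ).PosSemidef :=
  (tensor_posSemidef hγ).submatrix fun (p : (ι → α) × (ι → β)) i => (p.1 i, p.2 i)

theorem shuffle_isCompletelyReducible {ι α : Type*} [Fintype ι] [DecidableEq ι] [Fintype α]
    [DecidableEq α] {γ : ι → Matrix (α × α) (α × α) ℂ} (hγ : ∀ i, (γ i).PosSemidef)
    (h : ∀ i, IsPPT (γ i) ∨ IsPositiveUnderPTRealignment (γ i) ∨ IsRealignmentInvariant (γ i)) :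
    IsCompletelyReducible (shuffle γ) := by
  have hS := shuffle_posSemidef hγ
  choose k V hV using fun i => exists_isBlockFamily (h i)
  refine ⟨hS, (IsBlockFamily.tensor (fun A => ?_) hV).isCompletelyReducibleMap
    (isPerronMap_mapF_comp_mapG hS)⟩
  simp only [LinearMap.comp_apply, mapG_shuffle_tensor, mapF_shuffle_tensor]

/-! ### Recovering properties of the factors from a shuffle -/

section Factors

variable {ι α β : Type*} [Fintype ι] [DecidableEq ι]

theorem star_dotProduct_tensor_mulVec [Fintype α] (M : ι → Matrix α α ℂ) (v : ι → α → ℂ) :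
    star (fun p : ι → α => ∏ i, v i (p i)) ⬝ᵥ (tensor M *ᵥ fun p => ∏ i, v i (p i)) =
      ∏ i, star (v i) ⬝ᵥ (M i *ᵥ v i) := by
  simp only [dotProduct, mulVec, Finset.mul_sum, tensor_apply, Pi.star_apply, star_prod]
  rw [Finset.prod_univ_sum, Fintype.piFinset_univ]
  refine Finset.sum_congr rfl fun p _ => ?_
  rw [Finset.prod_univ_sum, Fintype.piFinset_univ]
  refine Finset.sum_congr rfl fun q _ => ?_
  rw [Finset.prod_mul_distrib, Finset.prod_mul_distrib]

/-- If a tensor product is positive semidefinite and each factor takes a positive value, then all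
factors are positive semidefinite. -/
theorem posSemidef_of_tensor_posSemidef [Fintype α] {M : ι → Matrix α α ℂ}
    (hM : (tensor M).PosSemidef) {v : ι → α → ℂ} (hv : ∀ i, 0 < star (v i) ⬝ᵥ (M i *ᵥ v i))
    (j : ι) : (M j).PosSemidef := by
  rw [posSemidef_iff_forall_nonneg]
  intro x
  have h := hM.dotProduct_mulVec_nonneg fun p => ∏ i, Function.update v j x i (p i)
  rw [star_dotProduct_tensor_mulVec, ← Finset.mul_prod_erase _ _ (Finset.mem_univ j),
    Function.update_self, Finset.prod_congr rfl fun i hi => by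
      rw [Function.update_of_ne (Finset.ne_of_mem_erase hi)]] at h
  have hb : 0 < ∏ i ∈ Finset.univ.erase j, star (v i) ⬝ᵥ (M i *ᵥ v i) :=
    Finset.prod_pos fun i _ => hv i
  set b := ∏ i ∈ Finset.univ.erase j, star (v i) ⬝ᵥ (M i *ᵥ v i)
  obtain ⟨hb1, hb2⟩ := Complex.lt_def.mp hb
  have hbr : b = ((b.re : ℝ) : ℂ) := Complex.ext rfl (by simpa using hb2.symm)
  have hinv : (0 : ℂ) ≤ ((b.re⁻¹ : ℝ) : ℂ) := by
    rw [Complex.zero_le_real]; exact inv_nonneg.mpr (le_of_lt hb1)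
  have := mul_nonneg h hinv
  rwa [mul_assoc, Complex.ofReal_inv, ← hbr, mul_inv_cancel₀ hb.ne', mul_one] at this

theorem posSemidef_of_shuffle_posSemidef [Fintype α] [Fintype β]
    {M : ι → Matrix (α × β) (α × β) ℂ} (hM : (shuffle M).PosSemidef) {v : ι → α × β → ℂ}
    (hv : ∀ i, 0 < star (v i) ⬝ᵥ (M i *ᵥ v i)) (j : ι) : (M j).PosSemidef := by
  refine posSemidef_of_tensor_posSemidef ?_ hv j
  exact (posSemidef_submatrix_equiv (M := tensor M)
    (Equiv.arrowProdEquivProdArrow ι (fun _ => α) (fun _ => β)).symm).mp hM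

/-- Tensor products that agree and do not vanish have proportional factors. -/
theorem exists_smul_eq_of_tensor_eq {M N : ι → Matrix α α ℂ} (h : tensor M = tensor N)
    (hM : ∀ i, M i ≠ 0) (j : ι) : ∃ c : ℂ, M j = c • N j := by
  have hex : ∀ i, ∃ p q, M i p q ≠ 0 := fun i => by
    by_contra hc
    push Not at hc
    exact hM i (Matrix.ext hc)
  choose P Q hPQ using hex
  have hprod : ∀ (A : ι → Matrix α α ℂ) (p q : α),
      tensor A (Function.update P j p) (Function.update Q j q) =
        A j p q * ∏ i ∈ Finset.univ.erase j, A i (P i) (Q i) := by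
    intro A p q
    rw [tensor_apply, ← Finset.mul_prod_erase _ _ (Finset.mem_univ j), Function.update_self,
      Function.update_self]
    congr 1
    refine Finset.prod_congr rfl fun i hi => ?_
    rw [Function.update_of_ne (Finset.ne_of_mem_erase hi),
      Function.update_of_ne (Finset.ne_of_mem_erase hi)]
  have hb : ∏ i ∈ Finset.univ.erase j, M i (P i) (Q i) ≠ 0 :=
    Finset.prod_ne_zero_iff.mpr fun i _ => hPQ i
  refine ⟨(∏ i ∈ Finset.univ.erase j, N i (P i) (Q i)) *
    (∏ i ∈ Finset.univ.erase j, M i (P i) (Q i))⁻¹, ?_⟩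
  ext p q
  have h1 := hprod M p q
  rw [h, hprod N] at h1
  rw [Matrix.smul_apply, smul_eq_mul, ← mul_inv_cancel_right₀ hb (M j p q), ← h1]
  ring

theorem exists_smul_eq_of_shuffle_eq {M N : ι → Matrix (α × β) (α × β) ℂ}
    (h : shuffle M = shuffle N) (hM : ∀ i, M i ≠ 0) (j : ι) : ∃ c : ℂ, M j = c • N j := by
  refine exists_smul_eq_of_tensor_eq ?_ hM j
  ext p q
  exact congrFun (congrFun h (fun i => (p i).1, fun i => (p i).2))
    (fun i => (q i).1, fun i => (q i).2)

end Factors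

section Conditions

theorem trace_pos {n : Type*} [Fintype n] {A : Matrix n n ℂ} (hA : A.PosSemidef) (h : A ≠ 0) :
    0 < A.trace :=
  lt_of_le_of_ne hA.trace_nonneg fun h0 => h (hA.trace_eq_zero_iff.mp h0.symm)

/-- Partial transposition keeps the diagonal, and a nonzero positive semidefinite matrix has a
positive diagonal entry. -/
theorem exists_partialTranspose_pos {α β : Type*} [Fintype α] [Fintype β]
    {γ : Matrix (α × β) (α × β) ℂ} (hγ : γ.PosSemidef) (h0 : γ ≠ 0) :
    ∃ v : α × β → ℂ, 0 < star v ⬝ᵥ (partialTranspose γ *ᵥ v) := by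
  classical
  have : ∃ p, γ p p ≠ 0 := by
    by_contra hc
    push Not at hc
    exact (trace_pos hγ h0).ne' (Finset.sum_eq_zero fun p _ => hc p)
  obtain ⟨p, hp⟩ := this
  refine ⟨Pi.single p 1, ?_⟩
  have : star (Pi.single p 1) ⬝ᵥ (partialTranspose γ *ᵥ Pi.single p 1) = γ p p := by
    rw [← Pi.single_star, star_one, single_one_dotProduct, mulVec_single_one]
    rfl
  rw [this]
  exact lt_of_le_of_ne hγ.diag_nonneg hp.symm

variable {α : Type*} [Fintype α] [DecidableEq α] {γ : Matrix (α × α) (α × α) ℂ}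

/-- The value of this quadratic form at the vectorized identity is `tr γ`. -/
theorem realignment_partialTranspose_pos (hγ : γ.PosSemidef) (h0 : γ ≠ 0) :
    0 < star (vecEquiv α 1) ⬝ᵥ (realignment (partialTranspose γ) *ᵥ vecEquiv α 1) := by
  rw [← vecEquiv_mapF, star_vecEquiv_dotProduct, conjTranspose_one, Matrix.mul_one,
    ← Matrix.one_mul (mapF γ 1), trace_mul_mapF, one_kronecker_one, Matrix.mul_one]
  exact trace_pos hγ h0

theorem trace_realignment (γ : Matrix (α × α) (α × α) ℂ) :
    (realignment γ).trace = star (vecEquiv α 1) ⬝ᵥ (γ *ᵥ vecEquiv α 1) := by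
  simp [Matrix.trace, realignment, dotProduct, mulVec, vecEquiv_apply, Fintype.sum_prod_type,
    Matrix.one_apply]

/-- A nonzero state that is proportional to its realignment is invariant under realignment. -/
theorem realignment_eq_of_eq_smul (hγ : γ.PosSemidef) (h0 : γ ≠ 0) {c : ℂ}
    (h : γ = c • realignment γ) : realignment γ = γ := by
  have h1 : realignment γ = c • γ := by
    conv_lhs => rw [h]
    -- Realignment is a linear involution.
    rfl
  have htr : (realignment γ).trace = c * γ.trace := by rw [h1, trace_smul, smul_eq_mul]
  have hpos := trace_pos hγ h0
  -- Being an involution forces `c * c = 1`; the sign of this trace rules out `c = -1`.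
  have hnn : 0 ≤ (realignment γ).trace := by
    rw [trace_realignment]; exact hγ.dotProduct_mulVec_nonneg _
  have hc : c * c = 1 := by
    have h2 : γ.trace = c * (c * γ.trace) := by
      conv_lhs => rw [h]
      rw [trace_smul, htr, smul_eq_mul]
    have h3 : (c * c - 1) * γ.trace = 0 := by linear_combination -h2
    exact sub_eq_zero.mp ((mul_eq_zero.mp h3).resolve_right hpos.ne')
  rcases mul_self_eq_one_iff.mp hc with rfl | rfl
  · rw [h1, one_smul]
  · rw [htr, neg_one_mul] at hnn
    exact absurd (le_antisymm (by simpa using hnn) hpos.le) hpos.ne'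

end Conditions

end BipartiteState

theorem mainTheorem5 (k n : ℕ) (hk : 2 < k)
    (γ : Fin n → Matrix (Fin k × Fin k) (Fin k × Fin k) ℂ)
    (hstate : ∀ j, BipartiteState.IsState (γ j))
    (hne : ∀ j, γ j ≠ 0)
    (hsome : ∀ j, BipartiteState.IsPPT (γ j) ∨
      BipartiteState.IsPositiveUnderPTRealignment (γ j) ∨
      BipartiteState.IsRealignmentInvariant (γ j))
    (h₁ : ∃ j, ¬ BipartiteState.IsPPT (γ j))
    (h₂ : ∃ j, ¬ BipartiteState.IsPositiveUnderPTRealignment (γ j))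
    (h₃ : ∃ j, ¬ BipartiteState.IsRealignmentInvariant (γ j)) :
    BipartiteState.IsCompletelyReducible (BipartiteState.shuffle γ) ∧
      ¬ BipartiteState.IsPPT (BipartiteState.shuffle γ) ∧
      ¬ BipartiteState.IsPositiveUnderPTRealignment (BipartiteState.shuffle γ) ∧
      ¬ BipartiteState.IsRealignmentInvariant (BipartiteState.shuffle γ) := by
  refine ⟨BipartiteState.shuffle_isCompletelyReducible hstate hsome, fun h => ?_, fun h => ?_,
    fun h => ?_⟩
  · obtain ⟨j, hj⟩ := h₁
    choose v hv using fun i =>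
      BipartiteState.exists_partialTranspose_pos (hstate i) (hne i)
    -- The partial transpose of a shuffle is, by definition, the shuffle of the partial transposes;
    -- the same holds for realignment below.
    exact hj ⟨hstate j, BipartiteState.posSemidef_of_shuffle_posSemidef
      (M := fun i => BipartiteState.partialTranspose (γ i)) h.2 hv j⟩
  · obtain ⟨j, hj⟩ := h₂
    exact hj ⟨hstate j, BipartiteState.posSemidef_of_shuffle_posSemidef
      (M := fun i => BipartiteState.realignment (BipartiteState.partialTranspose (γ i))) h.2
      (fun i => BipartiteState.realignment_partialTranspose_pos (hstate i) (hne i)) j⟩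
  · obtain ⟨j, hj⟩ := h₃
    have hS : BipartiteState.shuffle γ =
        BipartiteState.shuffle fun i => BipartiteState.realignment (γ i) := h.2.symm
    obtain ⟨c, hc⟩ := BipartiteState.exists_smul_eq_of_shuffle_eq hS hne j
    exact hj ⟨hstate j, BipartiteState.realignment_eq_of_eq_smul (hstate j) (hne j) hc⟩
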